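/- Let $G$ be a non-trivial countable discrete group that is ICC, i.e. every $g\in G\setminus\{e\}$ has an infinite conjugacy class, and let $A$ be a finite discrete alphabet with $|A|\ge 2$. Let $G$ act on $A^G$ (with the product topology) by left translations, $(gs)(h)=s(g^{-1}h)$. A *shift* is a non-empty closed $G$-invariant subset of $A^G$; the set of all shifts carries the Hausdorff (equivalently, Vietoris) topology. A shift $S$ is *strongly irreducible* if there is a finite $X\subseteq G$ containing $e$ such that for all $E_1,E_2\subseteq G$ with $E_1X\cap E_2X=\emptyset$ and all $s_1,s_2\in S$ there is an $s\in S$ with $s|_{E_1}=s_1|_{E_1}$ and $s|_{E_2}=s_2|_{E_2}$. Let $\mathcal S$ be the closure, in the space of shifts, of the set of strongly irreducible shifts, with the singleton shifts removed, endowed with the subspace topology. Then the set of those $S\in\mathcal S$ for which the action $G\curvearrowright S$ is minimal (every orbit is dense) and proximal (for all $x,y\in S$ there is a net $(g_i)$ in $G$ such that $\lim_i g_ix$ and $\lim_i g_iy$ exist and are equal) is a dense $G_\delta$ subset of $\mathcal S$. -/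

import Mathlib

open Topology TopologicalSpace Filter
open scoped Pointwise

/-- A group is ICC if each of its non-trivial elements has an infinite conjugacy class. -/
def IsICC (G : Type*) [Group G] : Prop :=
  ∀ g : G, g ≠ 1 → (conjugatesOf g).Infinite

/-- The left translation action on configurations: `(g s)(h) = s (g⁻¹ h)`. -/
def leftTranslate {G A : Type*} [Group G] (g : G) (s : G → A) : G → A :=
  fun h => s (g⁻¹ * h)

/-- The shifts: non-empty closed `G`-invariant subsets of `A^G`. For a finite discrete alphabet `A`
the space `A^G` is compact Hausdorff, so its non-empty closed subsets are its non-empty compact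
subsets. The space of shifts carries the subspace topology of the Vietoris topology,
which on the non-empty closed subsets of a compact metrizable space is the Hausdorff topology. -/
abbrev GShift (G A : Type*) [Group G] [TopologicalSpace A] : Type _ :=
  {S : NonemptyCompacts (G → A) // ∀ (g : G) (s : G → A), s ∈ S → leftTranslate g s ∈ S}

namespace GShift

variable {G A : Type*} [Group G] [TopologicalSpace A]

/-- The configurations of a shift, with the topology induced from `A^G`. -/
abbrev Point (S : GShift G A) : Type _ := {s : G → A // s ∈ S.1}

/-- The action of `G` on a shift by left translations. -/
instance (S : GShift G A) : MulAction G S.Point where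
  smul g s := ⟨leftTranslate g s.1, S.2 g s.1 s.2⟩
  one_smul s := by
    apply Subtype.ext
    funext h
    change s.1 (1⁻¹ * h) = s.1 h
    simp
  mul_smul g k s := by
    apply Subtype.ext
    funext h
    change s.1 ((g * k)⁻¹ * h) = s.1 (k⁻¹ * (g⁻¹ * h))
    rw [mul_inv_rev, mul_assoc]

/-- Strong irreducibility. -/
def IsStronglyIrreducible (S : GShift G A) : Prop :=
  ∃ X : Finset G, 1 ∈ X ∧ ∀ E₁ E₂ : Set G, Disjoint (E₁ * (X : Set G)) (E₂ * (X : Set G)) →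
    ∀ s₁ ∈ S.1, ∀ s₂ ∈ S.1, ∃ s ∈ S.1, Set.EqOn s s₁ E₁ ∧ Set.EqOn s s₂ E₂

/-- The trivial shifts are the singletons. -/
def IsTrivial (S : GShift G A) : Prop :=
  ∃ s : G → A, (S.1 : Set (G → A)) = {s}

end GShift

/-- The closure, in the space of shifts, of the strongly irreducible shifts, with the trivial shifts
removed. -/
def shiftSpace (G A : Type*) [Group G] [TopologicalSpace A] : Set (GShift G A) :=
  closure {S | S.IsStronglyIrreducible} \ {S | S.IsTrivial}

/-- An action of `G` on `X` is proximal if for all `x`, `y` there is a net `gᵢ` in `G` such that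
`lim gᵢ x = lim gᵢ y`. Nets are expressed as proper filters on `G`. -/
def IsProximalAction (G X : Type*) [Group G] [TopologicalSpace X] [MulAction G X] : Prop :=
  ∀ x y : X, ∃ (F : Filter G) (z : X), F.NeBot ∧
    Tendsto (fun g : G => g • x) F (𝓝 z) ∧ Tendsto (fun g : G => g • y) F (𝓝 z)

/-! Minimality and proximality hold as soon as `ApproxMinimal W` and `ApproxProximal W` hold for
every finite window W; for proximality this uses compactness. Each of these conditions is open,
there are countably many W, and the space in question is locally compact Hausdorff, hence Baire. So
it suffices to prove density for one W.

For density, let S be strongly irreducible. Some pattern s₀|K contains all W-patterns of S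
(`GShift.Glues.exists_rich`). Keep the configurations of S that carry this pattern at every point of
some member of a marker system. Strong irreducibility of S lets the pattern be planted freely, and
the amalgamation property of the markers keeps the result strongly irreducible. Every remaining
point sees all W-patterns, which is approximate minimality. Two members of the system always meet,
so any two points carry s₀|K at a common place, which is approximate proximality.

The heart is `IsICC.exists_isMarkerSystem`: sparse sets that always intersect. Put at each of sparse
centres C a large block B made of three distant copies yᵢ P₀ of a set P₀, and fill the rest with
small blocks H at the points of M. The set P₀ meets all relevant translates of H (a probabilistic
choice), so a copy at c yᵢ meets the other filling unless a centre c' of the other set blocks it. If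
all three copies are blocked, then by one and the same c', and the choice of the yᵢ
(`IsICC.exists_three`) forces c' = c, so two large blocks coincide. The ICC property enters through
B. H. Neumann's lemma on coverings by cosets. -/

/-! ### Counting subsets with prescribed traces -/

/-- Given pairwise disjoint blocks of size `v` in `D`, the proportion of the subsets of `D` whose
trace on each block differs from a prescribed one is at most `(1 - 2⁻ᵛ)` to the number of blocks. -/
theorem card_filter_trace_ne_mul_le {α ι : Type*} [DecidableEq α] [DecidableEq ι] (I : Finset ι)
    (B t : ι → Finset α) (v : ℕ) (hv : ∀ i ∈ I, (B i).card = v)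
    (hd : (I : Set ι).PairwiseDisjoint B) (ht : ∀ i ∈ I, t i ⊆ B i) (D : Finset α)
    (hD : ∀ i ∈ I, B i ⊆ D) :
    (D.powerset.filter fun S => ∀ i ∈ I, S ∩ B i ≠ t i).card * (2 ^ v) ^ I.card ≤
      (2 ^ v - 1) ^ I.card * 2 ^ D.card := by
  induction I using Finset.induction_on generalizing D with
  | empty => simp
  | insert i I hi ih =>
    have hdi : ∀ j ∈ I, Disjoint (B i) (B j) := fun j hj =>
      hd (by simp) (by simp [hj]) (by rintro rfl; exact hi hj)
    -- A subset is determined by its trace on `B i`, where one value is forbidden, and its part off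
    -- `B i`, which satisfies the remaining conditions.
    have key : (D.powerset.filter fun S => ∀ j ∈ insert i I, S ∩ B j ≠ t j).card ≤
        ((B i).powerset.erase (t i)).card *
          ((D \ B i).powerset.filter fun S => ∀ j ∈ I, S ∩ B j ≠ t j).card := by
      rw [← Finset.card_product]
      refine Finset.card_le_card_of_injOn (fun S => (S ∩ B i, S \ B i)) ?_ ?_
      · intro S hS
        simp only [Finset.coe_filter, Finset.mem_powerset, Set.mem_ofPred_eq,
          Finset.forall_mem_insert] at hS
        obtain ⟨h1, h2, h3⟩ := hS
        simp only [Finset.coe_product, Set.mem_prod, Finset.mem_coe, Finset.mem_erase,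
          Finset.mem_powerset, Finset.mem_filter]
        refine ⟨⟨h2, Finset.inter_subset_right⟩, Finset.sdiff_subset_sdiff h1 le_rfl, ?_⟩
        intro j hj
        have : (S \ B i) ∩ B j = S ∩ B j := by
          ext a
          have : a ∈ B i → a ∉ B j := fun h => Finset.disjoint_left.1 (hdi j hj) h
          simp only [Finset.mem_inter, Finset.mem_sdiff]
          tauto
        rw [this]
        exact h3 j hj
      · intro S _ S' _ h
        simp only [Prod.mk.injEq] at h
        rw [← Finset.sdiff_union_inter S (B i), h.1, h.2, Finset.sdiff_union_inter]
    have h1 : ((B i).powerset.erase (t i)).card = 2 ^ v - 1 := by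
      rw [Finset.card_erase_of_mem (Finset.mem_powerset.2 (ht i (by simp))), Finset.card_powerset,
        hv i (by simp)]
    have h2 : D.card = v + (D \ B i).card := by
      rw [Finset.card_sdiff_of_subset (hD i (by simp)), ← hv i (by simp)]
      have := Finset.card_le_card (hD i (by simp))
      omega
    have h3 := ih (fun j hj => hv j (by simp [hj])) (hd.subset (by simp))
      (fun j hj => ht j (by simp [hj])) (D \ B i) (fun j hj => by
        rw [Finset.subset_sdiff]
        exact ⟨hD j (by simp [hj]), (hdi j hj).symm⟩)
    rw [Finset.card_insert_of_notMem hi, h2]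
    rw [h1] at key
    calc _ ≤ ((2 ^ v - 1) *
          ((D \ B i).powerset.filter fun S => ∀ j ∈ I, S ∩ B j ≠ t j).card) *
            (2 ^ v) ^ (I.card + 1) := Nat.mul_le_mul_right _ key
      _ = (2 ^ v - 1) * 2 ^ v * (((D \ B i).powerset.filter fun S => ∀ j ∈ I, S ∩ B j ≠ t j).card *
            (2 ^ v) ^ I.card) := by ring
      _ ≤ (2 ^ v - 1) * 2 ^ v * ((2 ^ v - 1) ^ I.card * 2 ^ (D \ B i).card) :=
          Nat.mul_le_mul_left _ h3
      _ = _ := by ring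

/-- Exponential decay beats polynomial growth. With v = |V| and n = |H|, the factor n² v bounds |H V
H⁻¹| in the union bound below. -/
theorem exists_sq_mul_mul_pow_lt (v : ℕ) :
    ∃ n : ℕ, 0 < n ∧ n ^ 2 * v * (2 ^ v - 1) ^ n < (2 ^ v) ^ n := by
  have hp : (0 : ℝ) < 2 ^ v := by positivity
  have h1 : (1 : ℝ) ≤ 2 ^ v := one_le_pow₀ (by norm_num)
  have hr : |((2 : ℝ) ^ v - 1) / 2 ^ v| < 1 := by
    rw [abs_of_nonneg (div_nonneg (by linarith) hp.le), div_lt_one hp]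
    linarith
  have h := (tendsto_pow_const_mul_const_pow_of_abs_lt_one 2 hr).const_mul (v : ℝ)
  rw [mul_zero] at h
  obtain ⟨n, hn, hn0⟩ := ((h.eventually_lt_const one_pos).and (eventually_gt_atTop 0)).exists
  refine ⟨n, hn0, ?_⟩
  rw [div_pow, mul_div_assoc', mul_div_assoc', div_lt_one (by positivity)] at hn
  have : ((n ^ 2 * v * (2 ^ v - 1) ^ n : ℕ) : ℝ) < (((2 ^ v) ^ n : ℕ) : ℝ) := by
    push_cast [Nat.one_le_two_pow]
    linarith
  exact_mod_cast this

/-! ### Separated sets -/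

/-- Distinct elements of `P` do not differ by an element of `V`. -/
def SeparatedBy {G : Type*} [Group G] (V P : Set G) : Prop :=
  ∀ x ∈ P, ∀ y ∈ P, x⁻¹ * y ∈ V → x = y

section Groups

variable {G : Type*} [Group G]

/-- Greedy choice: an infinite group has an element off H V ∪ H, and by symmetry of V it can be
added to H. -/
theorem exists_separatedBy_card [Infinite G] (V : Finset G) (hV : ∀ v ∈ V, v⁻¹ ∈ V) (n : ℕ) :
    ∃ H : Finset G, H.card = n ∧ SeparatedBy (V : Set G) H := by
  classical
  induction n with
  | zero => exact ⟨∅, by simp, by simp [SeparatedBy]⟩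
  | succ n ih =>
    obtain ⟨H, hn, hH⟩ := ih
    obtain ⟨g, hg⟩ := Infinite.exists_notMem_finset (H * V ∪ H)
    simp only [Finset.mem_union, not_or] at hg
    have hg' : ∀ h ∈ H, h⁻¹ * g ∉ V := fun h hh hv =>
      hg.1 (Finset.mem_mul.2 ⟨h, hh, _, hv, by group⟩)
    refine ⟨insert g H, by rw [Finset.card_insert_of_notMem hg.2, hn], ?_⟩
    intro x hx y hy hxy
    simp only [Finset.coe_insert, Set.mem_insert_iff, Finset.mem_coe] at hx hy hxy
    rcases hx with rfl | hx <;> rcases hy with rfl | hy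
    · rfl
    · exact absurd (by simpa using hV _ hxy) (hg' y hy)
    · exact absurd hxy (hg' x hx)
    · exact hH x hx y hy hxy

/-- In an infinite group, some finite separated set meets all the translates `x H` of a suitable
finite separated set `H`, for `x ∈ H V H⁻¹`. -/
theorem exists_separatedBy_hitting [Infinite G] [DecidableEq G] (V : Finset G) (h1 : 1 ∈ V)
    (hV : ∀ v ∈ V, v⁻¹ ∈ V) :
    ∃ H P : Finset G, H.Nonempty ∧ SeparatedBy (V : Set G) H ∧ SeparatedBy (V : Set G) P ∧
      ∀ x ∈ H * V * H⁻¹, ∃ h ∈ H, x * h ∈ P := by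
  obtain ⟨n, hn0, hn⟩ := exists_sq_mul_mul_pow_lt V.card
  obtain ⟨H, hHn, hH⟩ := exists_separatedBy_card (V * V) (by
    intro v hv
    obtain ⟨a, ha, b, hb, rfl⟩ := Finset.mem_mul.1 hv
    exact Finset.mem_mul.2 ⟨_, hV b hb, _, hV a ha, by group⟩) n
  set Q := H * V * H⁻¹ with hQ
  set D := Q * H * V with hD
  have hQcard : Q.card ≤ n ^ 2 * V.card := by
    calc Q.card ≤ (H * V).card * H⁻¹.card := Finset.card_mul_le
      _ ≤ (H.card * V.card) * H⁻¹.card := Nat.mul_le_mul_right _ Finset.card_mul_le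
      _ = n ^ 2 * V.card := by rw [Finset.card_inv, hHn]; ring
  -- For a random S ⊆ D, `bad x` is the event that no x h is the only point of S in its block x h V.
  -- Since H is V V-separated, these blocks are disjoint, which bounds the probability by (1 - 2⁻ᵛ)ⁿ
  -- with v = |V|.
  let bad : G → Finset (Finset G) := fun x =>
    D.powerset.filter fun S => ∀ h ∈ H, S ∩ (V.image fun v => x * h * v) ≠ {x * h}
  have hbad : ∀ x ∈ Q, (bad x).card * (2 ^ V.card) ^ n ≤ (2 ^ V.card - 1) ^ n * 2 ^ D.card := by
    intro x hx
    have := card_filter_trace_ne_mul_le H (fun h => V.image fun v => x * h * v)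
      (fun h => {x * h}) V.card
      (fun h _ => Finset.card_image_of_injective _ (mul_right_injective _))
      (by
        intro h hh h' hh' hne
        rw [Function.onFun, Finset.disjoint_left]
        intro a ha ha'
        obtain ⟨v, hv, rfl⟩ := Finset.mem_image.1 ha
        obtain ⟨v', hv', he⟩ := Finset.mem_image.1 ha'
        refine hne (hH h hh h' hh' ?_)
        rw [Finset.mem_coe]
        refine Finset.mem_mul.2 ⟨v, hv, v'⁻¹, hV _ hv', ?_⟩
        have : h' * v' = h * v := by simpa [mul_assoc] using he
        rw [eq_inv_mul_iff_mul_eq, ← mul_assoc, ← this]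
        group)
      (fun h _ => by simpa using h1) D
      (fun h hh a ha => by
        obtain ⟨v, hv, rfl⟩ := Finset.mem_image.1 ha
        exact Finset.mul_mem_mul (Finset.mul_mem_mul hx hh) hv)
    rwa [hHn] at this
  -- Union bound over x ∈ Q.
  have hex : ∃ S ∈ D.powerset, S ∉ Q.biUnion bad := by
    by_contra! hcon
    have hle : D.powerset.card ≤ ∑ x ∈ Q, (bad x).card :=
      (Finset.card_le_card hcon).trans Finset.card_biUnion_le
    rw [Finset.card_powerset] at hle
    have h2 : 2 ^ D.card * (2 ^ V.card) ^ n ≤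
        n ^ 2 * V.card * (2 ^ V.card - 1) ^ n * 2 ^ D.card := by
      calc 2 ^ D.card * (2 ^ V.card) ^ n ≤ (∑ x ∈ Q, (bad x).card) * (2 ^ V.card) ^ n :=
            Nat.mul_le_mul_right _ hle
        _ = ∑ x ∈ Q, (bad x).card * (2 ^ V.card) ^ n := Finset.sum_mul _ _ _
        _ ≤ ∑ x ∈ Q, (2 ^ V.card - 1) ^ n * 2 ^ D.card := Finset.sum_le_sum hbad
        _ = Q.card * ((2 ^ V.card - 1) ^ n * 2 ^ D.card) := by simp
        _ ≤ (n ^ 2 * V.card) * ((2 ^ V.card - 1) ^ n * 2 ^ D.card) :=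
            Nat.mul_le_mul_right _ hQcard
        _ = _ := by ring
    rw [mul_comm (2 ^ D.card)] at h2
    exact absurd hn (not_lt.2 (Nat.le_of_mul_le_mul_right h2 (by positivity)))
  obtain ⟨S, hSD, hS⟩ := hex
  -- P consists of the V-isolated points of S, so its separation is automatic.
  refine ⟨H, S.filter fun z => S ∩ (V.image fun v => z * v) = {z}, ?_, ?_, ?_, ?_⟩
  · rw [← Finset.card_pos]; omega
  · intro x hx y hy hxy
    exact hH x hx y hy (Finset.mem_coe.2 (by simpa using Finset.mul_mem_mul hxy h1))
  · intro x hx y hy hxy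
    simp only [Finset.coe_filter, Set.mem_ofPred_eq] at hx hy
    have : y ∈ S ∩ (V.image fun v => x * v) :=
      Finset.mem_inter.2 ⟨hy.1, Finset.mem_image.2 ⟨_, hxy, by group⟩⟩
    rw [hx.2, Finset.mem_singleton] at this
    exact this.symm
  · intro x hx
    have : S ∉ bad x := fun h => hS (Finset.mem_biUnion.2 ⟨x, hx, h⟩)
    simp only [bad, Finset.mem_filter, hSD, true_and, not_forall, not_not] at this
    obtain ⟨h, hh, he⟩ := this
    refine ⟨h, hh, Finset.mem_filter.2 ⟨?_, he⟩⟩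
    have : x * h ∈ S ∩ (V.image fun v => x * h * v) := by rw [he]; simp
    exact (Finset.mem_inter.1 this).1

/-! ### Conjugates in ICC groups -/

theorem IsICC.infinite [Nontrivial G] (hG : IsICC G) : Infinite G := by
  obtain ⟨g, hg⟩ := exists_ne (1 : G)
  exact Set.infinite_univ_iff.1 ((hG g hg).mono (Set.subset_univ _))

/-- Orbit-stabilizer: the conjugates of g are indexed by the cosets of its centralizer. -/
theorem IsICC.not_finiteIndex_centralizer (hG : IsICC G) {g : G} (hg : g ≠ 1) :
    ¬ (Subgroup.centralizer {g}).FiniteIndex := by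
  intro hfin
  refine hG g hg ?_
  have : Finite (G ⧸ Subgroup.centralizer {g}) := Subgroup.finite_quotient_of_finiteIndex
  refine (Set.finite_range fun q : G ⧸ Subgroup.centralizer {g} =>
    q.out * g * q.out⁻¹).subset ?_
  intro x hx
  obtain ⟨c, rfl⟩ := isConj_iff.1 (show IsConj g x from hx)
  refine ⟨(c : G ⧸ Subgroup.centralizer {g}), ?_⟩
  obtain ⟨h, hh⟩ := QuotientGroup.mk_out_eq_mul (Subgroup.centralizer {g}) c
  have := Subgroup.mem_centralizer_singleton_iff.1 h.2
  dsimp only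
  rw [hh, mul_inv_rev, mul_assoc c, this]
  group

/-- In an ICC group, some element outside a given finite set conjugates each element of a finite
set of non-trivial elements out of another given finite set. -/
theorem IsICC.exists_conj_notMem [Nontrivial G] (hG : IsICC G) (N Φ L : Finset G) (hN : 1 ∉ N) :
    ∃ y, y ∉ L ∧ ∀ f ∈ N, y⁻¹ * f * y ∉ Φ := by
  classical
  have := hG.infinite
  by_contra! hcon
  let g : G ⊕ (G × G) → G := Sum.elim id fun p =>
    if h : ∃ y, y⁻¹ * p.1 * y = p.2 then h.choose else 1
  let K : G ⊕ (G × G) → Subgroup G := Sum.elim (fun _ => ⊥) fun p => Subgroup.centralizer {p.2}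
  -- The y with y⁻¹ f y = φ form a left coset of the centralizer of φ, or the empty set (then `g`
  -- takes an irrelevant default value). Elements of L are cosets of the trivial subgroup. So a
  -- failure covers G by finitely many cosets of subgroups of infinite index; φ = 1 is discarded
  -- because no f is trivial.
  have hcov : ⋃ i ∈ L.disjSum (N ×ˢ Φ.erase 1), g i • (K i : Set G) = Set.univ := by
    refine Set.eq_univ_of_forall fun y => ?_
    simp only [Set.mem_iUnion]
    by_cases hy : y ∈ L
    · exact ⟨Sum.inl y, by simpa using hy, by simp [g, K]⟩
    · obtain ⟨f, hf, hφ⟩ := hcon y hy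
      refine ⟨Sum.inr (f, y⁻¹ * f * y), ?_, ?_⟩
      · rw [Finset.inr_mem_disjSum, Finset.mem_product]
        refine ⟨hf, Finset.mem_erase.2 ⟨?_, hφ⟩⟩
        intro h
        have : f = 1 := by
          have := congrArg (fun z => y * z * y⁻¹) h
          simpa [mul_assoc] using this
        exact hN (this ▸ hf)
      · have hex : ∃ z, z⁻¹ * f * z = y⁻¹ * f * y := ⟨y, rfl⟩
        have hg : g (Sum.inr (f, y⁻¹ * f * y)) = hex.choose := dif_pos hex
        have hs := hex.choose_spec
        rw [hg, mem_leftCoset_iff]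
        set z := hex.choose
        change z⁻¹ * y ∈ Subgroup.centralizer {y⁻¹ * f * y}
        rw [Subgroup.mem_centralizer_singleton_iff]
        calc z⁻¹ * y * (y⁻¹ * f * y) = (z⁻¹ * f * z) * (z⁻¹ * y) := by group
          _ = _ := by rw [hs]
  obtain ⟨k, hk, hfin⟩ := Subgroup.exists_finiteIndex_of_leftCoset_cover hcov
  rcases k with k | ⟨f, φ⟩
  · change (⊥ : Subgroup G).FiniteIndex at hfin
    have := Subgroup.index_ne_zero_of_finite (H := (⊥ : Subgroup G))
    exact hfin.index_ne_zero (by rw [Subgroup.index_bot]; exact Nat.card_eq_zero_of_infinite)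
  · rw [Finset.inr_mem_disjSum, Finset.mem_product, Finset.mem_erase] at hk
    exact hG.not_finiteIndex_centralizer hk.2.1 hfin

/-- In an ICC group there are three elements whose relative displacements are in general position
with respect to given finite sets. -/
theorem IsICC.exists_three [Nontrivial G] (hG : IsICC G) (Φ L : Finset G) :
    ∃ y : Fin 3 → G, (∀ i j, i ≠ j → (y i)⁻¹ * y j ∉ L) ∧
      ∀ (j : Fin 3 → Fin 3) (f : G), (∀ i, (y i)⁻¹ * f * y (j i) ∈ Φ) → f = 1 := by
  classical
  have := hG.infinite
  obtain ⟨b, hb⟩ := Infinite.exists_notMem_finset (L ∪ L⁻¹ ∪ Φ * Φ⁻¹)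
  set A : Finset G := {1, b} with hA
  have h1A : (1 : G) ∈ A := by simp [hA]
  have hbA : b ∈ A := by simp [hA]
  -- The three excluded sets serve, in order, the separation of c from 1 and b, `hf1` and `hf3`. The
  -- conjugation property serves `hf2`; `hf4` rests on b ∉ Φ Φ⁻¹.
  obtain ⟨c, hc, hcN⟩ := hG.exists_conj_notMem ((Φ * A⁻¹).erase 1) Φ
    (A * (L ∪ L⁻¹) ∪ Φ * A⁻¹ * A * Φ⁻¹ ∪ A * Φ⁻¹ * {b⁻¹} * Φ) (by simp)
  simp only [Finset.mem_union, not_or] at hb hc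
  obtain ⟨⟨hbL, hbL'⟩, hbΦ⟩ := hb
  obtain ⟨⟨hcL, hcΦ⟩, hcΦ'⟩ := hc
  have hcL1 : ∀ a ∈ A, a⁻¹ * c ∉ L := fun a ha h =>
    hcL (Finset.mem_mul.2 ⟨a, ha, _, Finset.mem_union_left _ h, by group⟩)
  have hcL2 : ∀ a ∈ A, c⁻¹ * a ∉ L := fun a ha h =>
    hcL (Finset.mem_mul.2 ⟨a, ha, a⁻¹ * c,
      Finset.mem_union_right _ (Finset.mem_inv'.2 (by simpa using h)), by group⟩)
  have hf1 : ∀ f, ∀ a ∈ A, f * a ∈ Φ → ∀ a' ∈ A, c⁻¹ * f * a' ∉ Φ := by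
    intro f a ha hf a' ha' hf'
    refine hcΦ (Finset.mem_mul.2 ⟨f * a * a⁻¹ * a', ?_, (c⁻¹ * f * a')⁻¹, Finset.inv_mem_inv hf', by
      group⟩)
    exact Finset.mul_mem_mul (Finset.mul_mem_mul hf (Finset.inv_mem_inv ha)) ha'
  have hf2 : ∀ f, ∀ a ∈ A, f * a ∈ Φ → c⁻¹ * f * c ∈ Φ → f = 1 := by
    intro f a ha hf hf'
    by_contra hne
    exact hcN f (Finset.mem_erase.2 ⟨hne, Finset.mem_mul.2
      ⟨_, hf, a⁻¹, Finset.inv_mem_inv ha, by group⟩⟩) hf'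
  have hf3 : ∀ f, f * c ∈ Φ → ∀ a ∈ A, b⁻¹ * f * a ∉ Φ := by
    intro f hf a ha hf'
    refine hcΦ' (Finset.mem_mul.2 ⟨a * (b⁻¹ * f * a)⁻¹ * b⁻¹, ?_, f * c, hf, by group⟩)
    exact Finset.mul_mem_mul (Finset.mul_mem_mul ha (Finset.inv_mem_inv hf')) (by simp)
  have hf4 : ∀ f, f * c ∈ Φ → b⁻¹ * f * c ∉ Φ := by
    intro f hf hf'
    exact hbΦ (Finset.mem_mul.2 ⟨_, hf, _, Finset.inv_mem_inv hf', by group⟩)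
  refine ⟨![1, b, c], ?_, ?_⟩
  · intro i j hij
    fin_cases i <;> fin_cases j <;> first | exact absurd rfl hij | skip
    · simpa using hbL
    · simpa using hcL1 1 h1A
    · simpa using hbL'
    · simpa using hcL1 b hbA
    · simpa using hcL2 1 h1A
    · simpa using hcL2 b hbA
  · intro j f hf
    have e0 := hf 0
    have e1 := hf 1
    have e2 := hf 2
    generalize j 0 = j0 at e0
    generalize j 1 = j1 at e1
    generalize j 2 = j2 at e2
    have hlow : ∀ k : Fin 3, ![1, b, c] k ∈ A ∨ ![1, b, c] k = c := by
      intro k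
      fin_cases k
      · exact Or.inl h1A
      · exact Or.inl hbA
      · exact Or.inr rfl
    change (1 : G)⁻¹ * f * _ ∈ Φ at e0
    change b⁻¹ * f * _ ∈ Φ at e1
    change c⁻¹ * f * _ ∈ Φ at e2
    rw [inv_one, one_mul] at e0
    -- If y (j 0) lies in A, then y (j 2) must be c and the conjugation property gives f = 1. If y
    -- (j 0) = c, no value of j 1 is possible.
    rcases hlow j0 with h0 | h0
    · rcases hlow j2 with h2 | h2
      · exact absurd e2 (hf1 f _ h0 e0 _ h2)
      · rw [h2] at e2
        exact hf2 f _ h0 e0 e2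
    · rw [h0] at e0
      rcases hlow j1 with h1 | h1
      · exact absurd e1 (hf3 f e0 _ h1)
      · rw [h1] at e1
        exact absurd e1 (hf4 f e0)

end Groups

/-- The subset of `G` with a given indicator function. -/
def boolSet {G : Type*} (f : G → Bool) : Set G := {x | f x = true}

theorem mem_boolSet {G : Type*} {f : G → Bool} {x : G} : x ∈ boolSet f ↔ f x = true := Iff.rfl

open Classical in
theorem exists_boolSet_eq {G : Type*} (P : Set G) : ∃ f, boolSet f = P :=
  ⟨fun x => decide (x ∈ P), by ext x; simp [mem_boolSet]⟩

theorem isClopen_setOf_mem_boolSet {G X : Type*} [TopologicalSpace X] {f : X → G → Bool}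
    (hf : Continuous f) (x : G) : IsClopen {p | x ∈ boolSet (f p)} :=
  (isClopen_discrete {true}).preimage ((continuous_apply x).comp hf)

section Markers

variable {G : Type*} [Group G]

/-! ### Maximal separated sets -/

/-- `M` is a `Q`-separated subset of `D`, and each element of `D` is `Q`-close to `M`. For symmetric
`Q` containing `1`, these are the maximal `Q`-separated subsets of `D`. -/
def IsMaximalSeparated (Q D M : Set G) : Prop :=
  M ⊆ D ∧ SeparatedBy Q M ∧ ∀ x ∈ D, ∃ y ∈ M, y⁻¹ * x ∈ Q

theorem SeparatedBy.smul {V P : Set G} (h : SeparatedBy V P) (g : G) : SeparatedBy V (g • P) := by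
  rintro _ ⟨x, hx, rfl⟩ _ ⟨y, hy, rfl⟩ hxy
  simp only [smul_eq_mul] at hxy ⊢
  rw [h x hx y hy (by convert hxy using 1; group)]

theorem IsMaximalSeparated.smul {Q D M : Set G} (h : IsMaximalSeparated Q D M) (g : G) :
    IsMaximalSeparated Q (g • D) (g • M) := by
  refine ⟨Set.smul_set_mono h.1, h.2.1.smul g, ?_⟩
  rintro _ ⟨x, hx, rfl⟩
  obtain ⟨y, hy, hxy⟩ := h.2.2 x hx
  refine ⟨g • y, Set.smul_mem_smul_set hy, ?_⟩
  simp only [smul_eq_mul]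
  convert hxy using 1
  group

/-- Zorn's lemma; a point of D far from M could be added to M, by symmetry of Q. -/
theorem SeparatedBy.exists_isMaximalSeparated {Q D M₀ : Set G} (h1 : 1 ∈ Q)
    (hQ : ∀ q ∈ Q, q⁻¹ ∈ Q) (hM₀ : SeparatedBy Q M₀) (hD : M₀ ⊆ D) :
    ∃ M, M₀ ⊆ M ∧ IsMaximalSeparated Q D M := by
  obtain ⟨M, hM0, hM⟩ := zorn_subset_nonempty {M | M ⊆ D ∧ SeparatedBy Q M} (by
    intro c hc hchain _
    refine ⟨⋃₀ c, ⟨Set.sUnion_subset fun s hs => (hc hs).1, ?_⟩,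
      fun s hs => Set.subset_sUnion_of_mem hs⟩
    rintro x ⟨s, hs, hx⟩ y ⟨t, ht, hy⟩ hxy
    rcases hchain.total hs ht with h | h
    · exact (hc ht).2 x (h hx) y hy hxy
    · exact (hc hs).2 x hx y (h hy) hxy) M₀ ⟨hD, hM₀⟩
  refine ⟨M, hM0, hM.1.1, hM.1.2, ?_⟩
  intro x hx
  by_contra! hcon
  have hins : insert x M ∈ {M | M ⊆ D ∧ SeparatedBy Q M} := by
    refine ⟨Set.insert_subset hx hM.1.1, ?_⟩
    rintro a (rfl | ha) b (rfl | hb) hab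
    · rfl
    · exact absurd (by simpa using hQ _ hab) (hcon b hb)
    · exact absurd hab (hcon a ha)
    · exact hM.1.2 a ha b hb hab
  have := hM.2 hins (Set.subset_insert x M) (Set.mem_insert x M)
  exact hcon x this (by simpa using h1)

/-- Maximal separated subsets can be prescribed independently on distant sets. -/
theorem IsMaximalSeparated.exists_amalgam {Q D D₁ D₂ M₁ M₂ E₁ E₂ : Set G} (h1 : 1 ∈ Q)
    (hQ : ∀ q ∈ Q, q⁻¹ ∈ Q) (h₁ : IsMaximalSeparated Q D₁ M₁) (h₂ : IsMaximalSeparated Q D₂ M₂)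
    (hD₁ : ∀ x ∈ E₁ * Q, x ∈ D ↔ x ∈ D₁) (hD₂ : ∀ x ∈ E₂ * Q, x ∈ D ↔ x ∈ D₂)
    (hE : Disjoint (E₁ * Q * Q) (E₂ * Q)) :
    ∃ M, IsMaximalSeparated Q D M ∧ (∀ x ∈ E₁, x ∈ M ↔ x ∈ M₁) ∧ ∀ x ∈ E₂, x ∈ M ↔ x ∈ M₂ := by
  have hE' : ∀ x ∈ E₁ * Q, ∀ y ∈ E₂ * Q, x⁻¹ * y ∉ Q := by
    intro x hx y hy hxy
    refine Set.disjoint_left.1 hE ?_ hy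
    exact Set.mem_mul.2 ⟨x, hx, _, hxy, by group⟩
  obtain ⟨M, hM0, hM⟩ := SeparatedBy.exists_isMaximalSeparated (D := D)
    (M₀ := M₁ ∩ (E₁ * Q) ∪ M₂ ∩ (E₂ * Q)) h1 hQ (by
      rintro x (⟨hx, hx'⟩ | ⟨hx, hx'⟩) y (⟨hy, hy'⟩ | ⟨hy, hy'⟩) hxy
      · exact h₁.2.1 x hx y hy hxy
      · exact absurd hxy (hE' x hx' y hy')
      · exact absurd (by simpa using hQ _ hxy) (hE' y hy' x hx')
      · exact h₂.2.1 x hx y hy hxy) (by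
      rintro x (⟨hx, hx'⟩ | ⟨hx, hx'⟩)
      · exact (hD₁ x hx').2 (h₁.1 hx)
      · exact (hD₂ x hx').2 (h₂.1 hx))
  -- A point x of M in E' is Q-close to some y ∈ M'. This y lies in E' Q, hence in M, and separation
  -- of M gives y = x.
  have key : ∀ {D' M' E' : Set G}, IsMaximalSeparated Q D' M' →
      (∀ x ∈ E' * Q, x ∈ D ↔ x ∈ D') → M' ∩ (E' * Q) ⊆ M → ∀ x ∈ E', x ∈ M ↔ x ∈ M' := by
    intro D' M' E' h' hD' hsub x hx
    have hxQ : x ∈ E' * Q := Set.mem_mul.2 ⟨x, hx, 1, h1, mul_one x⟩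
    refine ⟨fun hxM => ?_, fun hxM => hsub ⟨hxM, hxQ⟩⟩
    obtain ⟨y, hy, hyx⟩ := h'.2.2 x ((hD' x hxQ).1 (hM.1 hxM))
    have hyM : y ∈ M := hsub ⟨hy, Set.mem_mul.2 ⟨x, hx, _, hQ _ hyx, by group⟩⟩
    rwa [← hM.2.1 y hyM x hxM hyx]
  exact ⟨M, hM, key h₁ hD₁ (Set.subset_union_left.trans hM0),
    key h₂ hD₂ (Set.subset_union_right.trans hM0)⟩

/-! ### Marker pairs -/

/-- `C` is a maximal `R`-separated set, and `M` is maximal among the `Q`-separated sets which avoid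
`C F`. -/
def IsMarkerPair (R F Q C M : Set G) : Prop :=
  IsMaximalSeparated R Set.univ C ∧ IsMaximalSeparated Q (C * F)ᶜ M

theorem mem_mul_iff_exists_inv {C F : Set G} {x : G} :
    x ∈ C * F ↔ ∃ f ∈ F, x * f⁻¹ ∈ C := by
  constructor
  · rintro ⟨c, hc, f, hf, rfl⟩
    exact ⟨f, hf, by simpa using hc⟩
  · rintro ⟨f, hf, h⟩
    exact ⟨_, h, f, hf, by group⟩

theorem exists_isMarkerPair {R F Q : Set G} (hR1 : 1 ∈ R) (hR : ∀ q ∈ R, q⁻¹ ∈ R) (hQ1 : 1 ∈ Q)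
    (hQ : ∀ q ∈ Q, q⁻¹ ∈ Q) : ∃ C M, IsMarkerPair R F Q C M := by
  obtain ⟨C, -, hC⟩ := SeparatedBy.exists_isMaximalSeparated (D := Set.univ) (M₀ := ∅) hR1 hR
    (by simp [SeparatedBy]) (by simp)
  obtain ⟨M, -, hM⟩ := SeparatedBy.exists_isMaximalSeparated (D := (C * F)ᶜ) (M₀ := ∅) hQ1 hQ
    (by simp [SeparatedBy]) (by simp)
  exact ⟨C, M, hC, hM⟩

theorem IsMarkerPair.smul {R F Q C M : Set G} (h : IsMarkerPair R F Q C M) (g : G) :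
    IsMarkerPair R F Q (g • C) (g • M) := by
  refine ⟨by simpa using h.1.smul g, ?_⟩
  have := h.2.smul g
  rwa [Set.smul_set_compl, ← smul_mul_assoc] at this

/-- Marker pairs can be prescribed independently on distant sets. -/
theorem IsMarkerPair.exists_amalgam {R F Q N C₁ M₁ C₂ M₂ E₁ E₂ : Set G} (hR1 : 1 ∈ R)
    (hR : ∀ q ∈ R, q⁻¹ ∈ R) (hQ1 : 1 ∈ Q) (hQ : ∀ q ∈ Q, q⁻¹ ∈ Q) (hN1 : 1 ∈ N) (hRN : R ⊆ N)
    (hQN : Q ⊆ N) (hFN : F⁻¹ ⊆ N) (h₁ : IsMarkerPair R F Q C₁ M₁) (h₂ : IsMarkerPair R F Q C₂ M₂)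
    (hE : Disjoint (E₁ * (N * N * N * N)) (E₂ * (N * N * N * N))) :
    ∃ C M, IsMarkerPair R F Q C M ∧ (∀ x ∈ E₁, (x ∈ C ↔ x ∈ C₁) ∧ (x ∈ M ↔ x ∈ M₁)) ∧
      ∀ x ∈ E₂, (x ∈ C ↔ x ∈ C₂) ∧ (x ∈ M ↔ x ∈ M₂) := by
  have hNN : ∀ E : Set G, E * N * N * N * N = E * (N * N * N * N) := fun E => by
    simp only [mul_assoc]
  have hle : ∀ E : Set G, E ⊆ E * N := fun E => Set.subset_mul_left E hN1
  -- C is prescribed on the larger sets Eᵢ N N, so that the region C F to be avoided by M is already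
  -- correct on Eᵢ Q.
  obtain ⟨C, hC, hC₁, hC₂⟩ := IsMaximalSeparated.exists_amalgam (D := Set.univ)
    (E₁ := E₁ * N * N) (E₂ := E₂ * N * N) hR1 hR h₁.1 h₂.1 (by simp) (by simp) (by
      refine Disjoint.mono ?_ ?_ hE
      · rw [← hNN]
        exact Set.mul_subset_mul (Set.mul_subset_mul le_rfl hRN) hRN
      · rw [← hNN]
        exact (Set.mul_subset_mul le_rfl hRN).trans (hle _))
  have hD : ∀ {C' E' : Set G}, (∀ x ∈ E' * N * N, x ∈ C ↔ x ∈ C') →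
      ∀ x ∈ E' * Q, x ∈ (C * F)ᶜ ↔ x ∈ (C' * F)ᶜ := by
    intro C' E' h x hx
    rw [Set.mem_compl_iff, Set.mem_compl_iff, mem_mul_iff_exists_inv, mem_mul_iff_exists_inv,
      not_iff_not]
    refine exists_congr fun f => and_congr_right fun hf => h _ ?_
    exact Set.mul_mem_mul (Set.mul_subset_mul le_rfl hQN hx) (hFN (Set.inv_mem_inv.2 hf))
  obtain ⟨M, hM, hM₁, hM₂⟩ := IsMaximalSeparated.exists_amalgam (D := (C * F)ᶜ)
    (E₁ := E₁) (E₂ := E₂) hQ1 hQ h₁.2 h₂.2 (hD hC₁) (hD hC₂) (by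
      refine Disjoint.mono ?_ ?_ hE
      · rw [← hNN]
        exact (Set.mul_subset_mul (Set.mul_subset_mul le_rfl hQN) hQN).trans
          ((hle _).trans (hle _))
      · rw [← hNN]
        exact (Set.mul_subset_mul le_rfl hQN).trans ((hle _).trans ((hle _).trans (hle _))))
  exact ⟨C, M, ⟨hC, hM⟩, fun x hx => ⟨hC₁ x (hle _ (hle _ hx)), hM₁ x hx⟩,
    fun x hx => ⟨hC₂ x (hle _ (hle _ hx)), hM₂ x hx⟩⟩

/-! ### Closedness of the marker conditions -/

theorem isClopen_setOf_mem_boolSet_mul {X : Type*} [TopologicalSpace X] {f : X → G → Bool}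
    (hf : Continuous f) (F : Finset G) (x : G) :
    IsClopen {p | x ∈ boolSet (f p) * (F : Set G)} := by
  have : {p | x ∈ boolSet (f p) * (F : Set G)} = ⋃ r ∈ F, {p | x * r⁻¹ ∈ boolSet (f p)} := by
    ext p
    simp [mem_mul_iff_exists_inv]
  rw [this]
  exact F.finite_toSet.isClopen_biUnion fun r _ => isClopen_setOf_mem_boolSet hf _

theorem isClosed_setOf_separatedBy_boolSet {X : Type*} [TopologicalSpace X] {f : X → G → Bool}
    (hf : Continuous f) (Q : Set G) : IsClosed {p | SeparatedBy Q (boolSet (f p))} := by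
  have : {p | SeparatedBy Q (boolSet (f p))} = ⋂ x, ⋂ y, {p | x ∈ boolSet (f p) →
      y ∈ boolSet (f p) → x⁻¹ * y ∈ Q → x = y} := by
    ext p
    simp only [Set.mem_iInter, Set.mem_ofPred_eq]
    exact ⟨fun h x y hx hy => h x hx y hy, fun h x hx y hy => h x y hx hy⟩
  rw [this]
  refine isClosed_iInter fun x => isClosed_iInter fun y => ?_
  have : {p | x ∈ boolSet (f p) → y ∈ boolSet (f p) → x⁻¹ * y ∈ Q → x = y} =
      {p | x ∈ boolSet (f p)}ᶜ ∪ ({p | y ∈ boolSet (f p)}ᶜ ∪ {_p | x⁻¹ * y ∈ Q → x = y}) := by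
    ext p
    simp only [Set.mem_union, Set.mem_compl_iff, Set.mem_ofPred_eq]
    tauto
  rw [this]
  exact (isClopen_setOf_mem_boolSet hf x).compl.isClosed.union
    ((isClopen_setOf_mem_boolSet hf y).compl.isClosed.union isClosed_const)

theorem isMaximalSeparated_iff {Q D M : Set G} :
    IsMaximalSeparated Q D M ↔ SeparatedBy Q M ∧ ∀ x, (x ∈ M → x ∈ D) ∧ (x ∈ D → x ∈ M * Q) := by
  have : ∀ x, x ∈ M * Q ↔ ∃ y ∈ M, y⁻¹ * x ∈ Q := fun x =>
    ⟨fun ⟨y, hy, q, hq, h⟩ => ⟨y, hy, by rw [← h]; simpa using hq⟩,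
      fun ⟨y, hy, h⟩ => ⟨y, hy, _, h, by simp⟩⟩
  simp only [this, IsMaximalSeparated, forall_and, Set.subset_def]
  tauto

theorem isClosed_setOf_isMaximalSeparated_boolSet {X : Type*} [TopologicalSpace X]
    {f : X → G → Bool} (hf : Continuous f) (Q : Finset G) {D : X → Set G}
    (hD : ∀ x, IsClopen {p | x ∈ D p}) :
    IsClosed {p | IsMaximalSeparated (Q : Set G) (D p) (boolSet (f p))} := by
  have : {p | IsMaximalSeparated (Q : Set G) (D p) (boolSet (f p))} =
      {p | SeparatedBy (Q : Set G) (boolSet (f p))} ∩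
        ⋂ x, (({p | x ∈ boolSet (f p)}ᶜ ∪ {p | x ∈ D p}) ∩
          ({p | x ∈ D p}ᶜ ∪ {p | x ∈ boolSet (f p) * (Q : Set G)})) := by
    ext p
    simp only [Set.mem_ofPred_eq, isMaximalSeparated_iff, Set.mem_inter_iff, Set.mem_iInter,
      Set.mem_union, Set.mem_compl_iff, imp_iff_not_or]
  rw [this]
  exact (isClosed_setOf_separatedBy_boolSet hf _).inter (isClosed_iInter fun x =>
    ((isClopen_setOf_mem_boolSet hf x).compl.union (hD x)).isClosed.inter
      ((hD x).compl.union (isClopen_setOf_mem_boolSet_mul hf Q x)).isClosed)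

theorem isClosed_setOf_isMarkerPair_boolSet (R F Q : Finset G) :
    IsClosed {p : (G → Bool) × (G → Bool) |
      IsMarkerPair (R : Set G) (F : Set G) (Q : Set G) (boolSet p.1) (boolSet p.2)} :=
  (isClosed_setOf_isMaximalSeparated_boolSet continuous_fst R
    (D := fun _ => Set.univ) fun x => by simpa using isClopen_univ).inter
  (isClosed_setOf_isMaximalSeparated_boolSet continuous_snd Q
    (D := fun p => (boolSet p.1 * (F : Set G))ᶜ) fun x =>
      (isClopen_setOf_mem_boolSet_mul continuous_fst F x).compl)

/-! ### Systems of markers -/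

/-- A closed, translation invariant and strongly irreducible family of `V`-separated subsets of `G`,
any two of which meet. -/
structure IsMarkerSystem (V : Set G) (𝓜 : Set (Set G)) : Prop where
  nonempty : 𝓜.Nonempty
  isClosed : IsClosed {f : G → Bool | boolSet f ∈ 𝓜}
  smul_mem : ∀ P ∈ 𝓜, ∀ g : G, g • P ∈ 𝓜
  separatedBy : ∀ P ∈ 𝓜, SeparatedBy V P
  inter_nonempty : ∀ P ∈ 𝓜, ∀ P' ∈ 𝓜, (P ∩ P').Nonempty
  exists_amalgam : ∃ X : Finset G, 1 ∈ X ∧ ∀ E₁ E₂ : Set G,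
    Disjoint (E₁ * (X : Set G)) (E₂ * (X : Set G)) → ∀ P₁ ∈ 𝓜, ∀ P₂ ∈ 𝓜,
      ∃ P ∈ 𝓜, (∀ x ∈ E₁, x ∈ P ↔ x ∈ P₁) ∧ ∀ x ∈ E₂, x ∈ P ↔ x ∈ P₂

/-- The sets `C B ∪ M H` for the marker pairs `(C, M)`. -/
def markerFamily (R F Q B H : Set G) : Set (Set G) :=
  {P | ∃ C M, IsMarkerPair R F Q C M ∧ P = C * B ∪ M * H}

/-- P need not determine (C, M), so closedness is obtained by compactness: the family is a
continuous image of the compact space of marker pairs. -/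
theorem isClosed_markerFamily (R F Q B H : Finset G) :
    IsClosed {f : G → Bool | boolSet f ∈ markerFamily (R : Set G) F Q B H} := by
  classical
  let Ψ : (G → Bool) × (G → Bool) → G → Bool := fun p x =>
    decide (x ∈ boolSet p.1 * (B : Set G) ∪ boolSet p.2 * (H : Set G))
  have hΨmem : ∀ p, boolSet (Ψ p) = boolSet p.1 * (B : Set G) ∪ boolSet p.2 * (H : Set G) := by
    intro p
    ext x
    rw [mem_boolSet, decide_eq_true_iff]
  have hΨ : Continuous Ψ := by
    refine continuous_pi fun x => (continuous_bool_rng true).2 ?_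
    have := (isClopen_setOf_mem_boolSet_mul (f := Prod.fst) continuous_fst B x).union
      (isClopen_setOf_mem_boolSet_mul (X := (G → Bool) × (G → Bool)) continuous_snd H x)
    convert this using 1
    ext p
    simp [Ψ]
  have himg : {f : G → Bool | boolSet f ∈ markerFamily (R : Set G) F Q B H} =
      Ψ '' {p | IsMarkerPair (R : Set G) (F : Set G) (Q : Set G) (boolSet p.1) (boolSet p.2)} := by
    ext f
    constructor
    · rintro ⟨C, M, hCM, hf⟩
      obtain ⟨c, rfl⟩ := exists_boolSet_eq C
      obtain ⟨m, rfl⟩ := exists_boolSet_eq M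
      refine ⟨(c, m), hCM, ?_⟩
      funext x
      rw [Bool.eq_iff_iff, ← mem_boolSet, ← mem_boolSet, hΨmem, hf]
    · rintro ⟨p, hp, rfl⟩
      exact ⟨_, _, hp, hΨmem p⟩
  rw [himg]
  exact ((isClosed_setOf_isMarkerPair_boolSet R F Q).isCompact.image hΨ).isClosed

/-- Whether x lies in C B ∪ M H depends only on C along x B⁻¹ and M along x H⁻¹, so the amalgamation
of marker pairs passes to the family. -/
theorem exists_amalgam_markerFamily {R F Q B H : Finset G} (hR1 : 1 ∈ R)
    (hR : ∀ q ∈ R, q⁻¹ ∈ R) (hQ1 : 1 ∈ Q) (hQ : ∀ q ∈ Q, q⁻¹ ∈ Q) :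
    ∃ X : Finset G, 1 ∈ X ∧ ∀ E₁ E₂ : Set G,
      Disjoint (E₁ * (X : Set G)) (E₂ * (X : Set G)) →
        ∀ P₁ ∈ markerFamily (R : Set G) F Q B H, ∀ P₂ ∈ markerFamily (R : Set G) F Q B H,
          ∃ P ∈ markerFamily (R : Set G) F Q B H,
            (∀ x ∈ E₁, x ∈ P ↔ x ∈ P₁) ∧ ∀ x ∈ E₂, x ∈ P ↔ x ∈ P₂ := by
  classical
  set N : Finset G := insert 1 (R ∪ Q ∪ F⁻¹) with hN
  refine ⟨insert 1 ((B⁻¹ ∪ H⁻¹) * (N * N * N * N)), by simp, ?_⟩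
  rintro E₁ E₂ hE P₁ ⟨C₁, M₁, h₁, rfl⟩ P₂ ⟨C₂, M₂, h₂, rfl⟩
  have hsub : ∀ E : Set G, E * ((B : Set G)⁻¹ ∪ (H : Set G)⁻¹) *
      ((N : Set G) * N * N * N) ⊆ E * ((insert 1 ((B⁻¹ ∪ H⁻¹) * (N * N * N * N)) : Finset G)) := by
    intro E
    rw [mul_assoc E]
    refine Set.mul_subset_mul le_rfl ?_
    push_cast
    exact Set.subset_insert _ _
  obtain ⟨C, M, hCM, hc₁, hc₂⟩ := IsMarkerPair.exists_amalgam (N := (N : Set G))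
    (E₁ := E₁ * ((B : Set G)⁻¹ ∪ (H : Set G)⁻¹)) (E₂ := E₂ * ((B : Set G)⁻¹ ∪ (H : Set G)⁻¹))
    (by exact_mod_cast hR1) (by exact_mod_cast hR) (by exact_mod_cast hQ1) (by exact_mod_cast hQ)
    (by simp [hN]) (by rw [Finset.coe_subset]; intro x hx; simp [hN, hx])
    (by rw [Finset.coe_subset]; intro x hx; simp [hN, hx])
    (by rw [← Finset.coe_inv, Finset.coe_subset]; intro x hx; simp only [hN, Finset.mem_insert,
          Finset.mem_union, hx, or_true]) h₁ h₂ (hE.mono (hsub _) (hsub _))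
  have key : ∀ {C' M' E : Set G}, (∀ x ∈ E * ((B : Set G)⁻¹ ∪ (H : Set G)⁻¹),
      (x ∈ C ↔ x ∈ C') ∧ (x ∈ M ↔ x ∈ M')) → ∀ x ∈ E,
        x ∈ C * (B : Set G) ∪ M * (H : Set G) ↔ x ∈ C' * (B : Set G) ∪ M' * (H : Set G) := by
    intro C' M' E h x hx
    simp only [Set.mem_union, mem_mul_iff_exists_inv]
    refine or_congr (exists_congr fun b => and_congr_right fun hb => (h _ ?_).1)
      (exists_congr fun b => and_congr_right fun hb => (h _ ?_).2)
    · exact Set.mul_mem_mul hx (Or.inl (Set.inv_mem_inv.2 hb))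
    · exact Set.mul_mem_mul hx (Or.inr (Set.inv_mem_inv.2 hb))
  exact ⟨_, ⟨C, M, hCM, rfl⟩, key hc₁, key hc₂⟩

/-- Close points cannot lie in different blocks: R separates the large blocks, Q the small ones, and
M avoids C F, which keeps small blocks away from large ones. -/
theorem separatedBy_of_mem_markerFamily {R F Q B H V : Set G} (hV : ∀ v ∈ V, v⁻¹ ∈ V)
    (hB : SeparatedBy V B) (hH : SeparatedBy V H) (hR : B * V * B⁻¹ ⊆ R) (hF : B * V * H⁻¹ ⊆ F)
    (hQ : H * V * H⁻¹ ⊆ Q) {P : Set G} (hP : P ∈ markerFamily R F Q B H) : SeparatedBy V P := by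
  obtain ⟨C, M, hCM, rfl⟩ := hP
  have hself : ∀ {R' D C' B' : Set G}, IsMaximalSeparated R' D C' → B' * V * B'⁻¹ ⊆ R' →
      SeparatedBy V B' → SeparatedBy V (C' * B') := by
    rintro R' D C' B' hC' hR' hB' _ ⟨c, hc, b, hb, rfl⟩ _ ⟨c', hc', b', hb', rfl⟩ hv
    simp only at hv ⊢
    have : c = c' := by
      refine hC'.2.1 c hc c' hc' (hR' ?_)
      exact ⟨b * ((c * b)⁻¹ * (c' * b')), ⟨b, hb, _, hv, rfl⟩, b'⁻¹, Set.inv_mem_inv.2 hb', by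
        group⟩
    subst this
    rw [hB' b hb b' hb' (by convert hv using 1; group)]
  have hcross : ∀ x ∈ C * B, ∀ y ∈ M * H, x⁻¹ * y ∉ V := by
    rintro _ ⟨c, hc, b, hb, rfl⟩ _ ⟨m, hm, h, hh, rfl⟩ hv
    simp only at hv
    refine hCM.2.1 hm ⟨c, hc, c⁻¹ * m, hF ?_, by simp⟩
    exact ⟨b * ((c * b)⁻¹ * (m * h)), ⟨b, hb, _, hv, rfl⟩, h⁻¹, Set.inv_mem_inv.2 hh, by group⟩
  rintro x (hx | hx) y (hy | hy) hxy
  · exact hself hCM.1 hR hB x hx y hy hxy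
  · exact absurd hxy (hcross x hx y hy)
  · exact absurd (by simpa using hV _ hxy) (hcross y hy x hx)
  · exact hself hCM.2 hQ hH x hx y hy hxy

/-- Every ICC group has systems of markers with arbitrary separation. -/
theorem IsICC.exists_isMarkerSystem [Nontrivial G] (hG : IsICC G) (V : Finset G) (h1 : 1 ∈ V)
    (hV : ∀ v ∈ V, v⁻¹ ∈ V) : ∃ 𝓜, IsMarkerSystem (V : Set G) 𝓜 := by
  classical
  have := hG.infinite
  obtain ⟨H, P₀, hHne, hH, hP₀, hhit⟩ := exists_separatedBy_hitting V h1 hV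
  set Q := H * V * H⁻¹ with hQdef
  obtain ⟨h₀, hh₀⟩ := hHne
  have hQ1 : 1 ∈ Q := Finset.mem_mul.2 ⟨h₀, by simpa using Finset.mul_mem_mul hh₀ h1, h₀⁻¹,
    Finset.inv_mem_inv hh₀, by simp⟩
  have hsymm : ∀ K : Finset G, ∀ q ∈ K * V * K⁻¹, q⁻¹ ∈ K * V * K⁻¹ := by
    intro K q hq
    obtain ⟨a, ha, b, hb, rfl⟩ := Finset.mem_mul.1 hq
    obtain ⟨k, hk, v, hv, rfl⟩ := Finset.mem_mul.1 ha
    exact Finset.mem_mul.2 ⟨b⁻¹ * v⁻¹, Finset.mul_mem_mul (Finset.mem_inv'.1 hb) (hV v hv), k⁻¹,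
      Finset.inv_mem_inv hk, by group⟩
  obtain ⟨p₀, hp₀⟩ : ∃ p, p ∈ P₀ := by
    obtain ⟨h, -, hp⟩ := hhit 1 hQ1
    exact ⟨_, hp⟩
  obtain ⟨y, hyL, hyΦ⟩ := hG.exists_three (H * V * P₀⁻¹) (P₀ * V * P₀⁻¹)
  set Y := Finset.univ.image y with hY
  have hyY : ∀ i, y i ∈ Y := fun i => by simp [hY]
  set B := Y * P₀ with hBdef
  -- Z contains the displacement from c to any centre blocking one of the copies c yᵢ P₀. Including
  -- Z⁻¹ Z in R makes the blocking centre unique.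
  set Z := Y * (H * V * P₀⁻¹) * Y⁻¹ with hZ
  set R := Z⁻¹ * Z ∪ B * V * B⁻¹ with hRdef
  set F := B * V * H⁻¹ with hFdef
  have hR1 : 1 ∈ R := Finset.mem_union_right _ (Finset.mem_mul.2 ⟨y 0 * p₀,
    by simpa using Finset.mul_mem_mul (Finset.mul_mem_mul (hyY 0) hp₀) h1, (y 0 * p₀)⁻¹,
    Finset.inv_mem_inv (Finset.mul_mem_mul (hyY 0) hp₀), by simp⟩)
  have hR : ∀ q ∈ R, q⁻¹ ∈ R := by
    intro q hq
    rcases Finset.mem_union.1 hq with hq | hq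
    · obtain ⟨a, ha, b, hb, rfl⟩ := Finset.mem_mul.1 hq
      exact Finset.mem_union_left _ (Finset.mem_mul.2
        ⟨b⁻¹, Finset.inv_mem_inv hb, a⁻¹, Finset.mem_inv'.1 ha, by group⟩)
    · exact Finset.mem_union_right _ (hsymm _ _ hq)
  have hB : SeparatedBy (V : Set G) (B : Set G) := by
    intro a ha b hb hab
    obtain ⟨_, hi, p, hp, rfl⟩ := Finset.mem_mul.1 (Finset.mem_coe.1 ha)
    obtain ⟨_, hj, q, hq, rfl⟩ := Finset.mem_mul.1 (Finset.mem_coe.1 hb)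
    obtain ⟨i, -, rfl⟩ := Finset.mem_image.1 hi
    obtain ⟨j, -, rfl⟩ := Finset.mem_image.1 hj
    have hij : i = j := by
      by_contra hne
      refine hyL i j hne (Finset.mem_mul.2 ⟨p * ((y i * p)⁻¹ * (y j * q)),
        Finset.mul_mem_mul hp hab, q⁻¹, Finset.inv_mem_inv hq, by group⟩)
    subst hij
    rw [hP₀ p hp q hq (by convert hab using 1; group)]
  refine ⟨markerFamily (R : Set G) F Q B H, ?_, isClosed_markerFamily R F Q B H, ?_, ?_, ?_,
    exists_amalgam_markerFamily hR1 hR hQ1 (hsymm H)⟩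
  · obtain ⟨C, M, h⟩ := exists_isMarkerPair (R := (R : Set G)) (F := (F : Set G)) (Q := (Q : Set G))
      (by exact_mod_cast hR1) (by exact_mod_cast hR) (by exact_mod_cast hQ1)
      (by exact_mod_cast hsymm H)
    exact ⟨_, C, M, h, rfl⟩
  · rintro _ ⟨C, M, h, rfl⟩ g
    exact ⟨_, _, h.smul g, by rw [Set.smul_set_union, smul_mul_assoc, smul_mul_assoc]⟩
  · intro P hP
    refine separatedBy_of_mem_markerFamily (by exact_mod_cast hV) hB hH ?_ ?_ ?_ hP
    · rw [hRdef]; push_cast; exact Set.subset_union_right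
    · rw [hFdef]; push_cast; exact le_rfl
    · rw [hQdef]; push_cast; exact le_rfl
  · rintro _ ⟨C, M, h, rfl⟩ _ ⟨C', M', h', rfl⟩
    obtain ⟨c, hc, -⟩ := h.1.2.2 1 (Set.mem_univ _)
    have hBmem : ∀ i, ∀ p ∈ P₀, y i * p ∈ B := fun i p hp => Finset.mul_mem_mul (hyY i) hp
    by_cases hcC' : c ∈ C'
    · exact ⟨c * (y 0 * p₀), Or.inl ⟨c, hc, _, hBmem 0 p₀ hp₀, rfl⟩,
        Or.inl ⟨c, hcC', _, hBmem 0 p₀ hp₀, rfl⟩⟩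
    -- Otherwise a single c' ∈ C' blocks all three copies, and general position of the yᵢ gives c' =
    -- c.
    obtain ⟨i, hi⟩ : ∃ i, c * y i ∉ C' * (F : Set G) := by
      by_contra! hcon
      have hex : ∀ i, ∃ c' ∈ C', ∃ j, (y i)⁻¹ * (c⁻¹ * c') * y j ∈ H * V * P₀⁻¹ := by
        intro i
        obtain ⟨c', hc', f, hf, he⟩ := hcon i
        obtain ⟨a, ha, h, hh, rfl⟩ := Finset.mem_mul.1 (Finset.mem_coe.1 hf)
        obtain ⟨b, hb, v, hv, rfl⟩ := Finset.mem_mul.1 ha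
        obtain ⟨_, hj, p, hp, rfl⟩ := Finset.mem_mul.1 hb
        obtain ⟨j, -, rfl⟩ := Finset.mem_image.1 hj
        refine ⟨c', hc', j, Finset.mem_mul.2 ⟨h⁻¹ * v⁻¹, Finset.mul_mem_mul (Finset.mem_inv'.1 hh)
          (hV v hv), p⁻¹, Finset.inv_mem_inv hp, ?_⟩⟩
        simp only at he
        have : c = c' * (y j * p * v * h) * (y i)⁻¹ := by rw [he]; group
        rw [this]
        group
      choose c' hc' j hj using hex
      have hZmem : ∀ i, c⁻¹ * c' i ∈ Z := fun i => Finset.mem_mul.2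
        ⟨_, Finset.mul_mem_mul (hyY i) (hj i), (y (j i))⁻¹, Finset.inv_mem_inv (hyY _), by group⟩
      have heq : ∀ i, c' i = c' 0 := by
        intro i
        refine h'.1.2.1 _ (hc' i) _ (hc' 0) (Finset.mem_coe.2 (Finset.mem_union_left _ ?_))
        exact Finset.mem_mul.2 ⟨(c⁻¹ * c' i)⁻¹, Finset.inv_mem_inv (hZmem i), _, hZmem 0, by group⟩
      have := hyΦ j (c⁻¹ * c' 0) fun i => by rw [← heq i]; exact hj i
      rw [inv_mul_eq_one] at this
      exact hcC' (this ▸ hc' 0)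
    obtain ⟨m, hm, hmQ⟩ := h'.2.2.2 (c * y i) hi
    -- P₀ meets the translate (c yᵢ)⁻¹ m H, so c yᵢ P₀ contains some m h.
    obtain ⟨h, hh, hp⟩ := hhit _ (hsymm H _ hmQ)
    refine ⟨m * h, Or.inl ⟨c, hc, y i * ((m⁻¹ * (c * y i))⁻¹ * h), hBmem i _ hp, ?_⟩,
      Or.inr ⟨m, hm, h, hh, rfl⟩⟩
    simp only
    group

end Markers

/-! ### Gluing in strongly irreducible shifts -/

section Shifts

variable {G A : Type*} [Group G] [TopologicalSpace A]

/-- `X` witnesses strong irreducibility of `S`. -/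
def GShift.Glues (S : GShift G A) (X : Finset G) : Prop :=
  ∀ E₁ E₂ : Set G, Disjoint (E₁ * (X : Set G)) (E₂ * (X : Set G)) →
    ∀ s₁ ∈ S.1, ∀ s₂ ∈ S.1, ∃ s ∈ S.1, Set.EqOn s s₁ E₁ ∧ Set.EqOn s s₂ E₂

/-- In a strongly irreducible shift, arbitrary families of partial configurations with pairwise
distant domains can be glued. -/
theorem GShift.Glues.exists_forall_eqOn [DiscreteTopology A] {S : GShift G A} {X : Finset G}
    (hX : S.Glues X) {ι : Type*} (E : ι → Set G) (s : ι → G → A) (hs : ∀ i, s i ∈ S.1)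
    (hE : ∀ i j, i ≠ j → Disjoint (E i * (X : Set G)) (E j * (X : Set G))) :
    ∃ t ∈ S.1, ∀ i, Set.EqOn t (s i) (E i) := by
  classical
  have hfin : ∀ I : Finset ι, ∃ t ∈ S.1, ∀ i ∈ I, Set.EqOn t (s i) (E i) := by
    intro I
    induction I using Finset.induction_on with
    | empty =>
      obtain ⟨t, ht⟩ := S.1.nonempty
      exact ⟨t, ht, by simp⟩
    | insert i I hi ih =>
      obtain ⟨t, ht, htI⟩ := ih
      obtain ⟨u, hu, hui, hut⟩ := hX (E i) (⋃ j ∈ I, E j) (by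
        rw [Set.disjoint_left]
        rintro _ hx ⟨y, hy, g, hg, rfl⟩
        simp only [Set.mem_iUnion] at hy
        obtain ⟨j, hj, hy⟩ := hy
        exact Set.disjoint_left.1 (hE i j (by rintro rfl; exact hi hj)) hx
          (Set.mul_mem_mul hy hg)) (s i) (hs i) t ht
      refine ⟨u, hu, ?_⟩
      intro j hj
      rcases Finset.mem_insert.1 hj with rfl | hj
      · exact hui
      · intro x hx
        rw [hut (Set.mem_biUnion hj hx), htI j hj hx]
  have := S.1.isCompact.inter_iInter_nonempty (fun i => {t | Set.EqOn t (s i) (E i)})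
    (fun i => by
      have : {t : G → A | Set.EqOn t (s i) (E i)} = ⋂ x ∈ E i, {t | t x = s i x} := by
        ext t
        simp [Set.EqOn]
      rw [this]
      exact isClosed_biInter fun x _ => isClosed_eq (continuous_apply x) continuous_const)
    (fun I => by
      obtain ⟨t, ht, htI⟩ := hfin I
      exact ⟨t, ht, by simpa using htI⟩)
  obtain ⟨t, ht, ht'⟩ := this
  exact ⟨t, ht, fun i => Set.mem_iInter.1 ht' i⟩

/-- In a strongly irreducible shift, some finite pattern contains all the patterns of a given finite
shape. -/
theorem GShift.Glues.exists_rich [DiscreteTopology A] [Finite A] [Infinite G] {S : GShift G A}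
    {X : Finset G} (hX : S.Glues X) (W : Finset G) :
    ∃ s₀ ∈ S.1, ∃ K : Finset G, ∀ s ∈ S.1, ∃ k, ∀ w ∈ W, k * w ∈ K ∧ s₀ (k * w) = s w := by
  classical
  -- The finitely many W-patterns of S are placed at the points of a separated set indexed by them.
  let ι := {p : W → A // ∃ s ∈ S.1, ∀ w : W, s w = p w}
  have : Fintype ι := Fintype.ofFinite ι
  choose r hrS hr using fun p : ι => p.2
  obtain ⟨H, hcard, hH⟩ := exists_separatedBy_card ((W * X) * (W * X)⁻¹) (by
    intro v hv
    obtain ⟨a, ha, b, hb, rfl⟩ := Finset.mem_mul.1 hv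
    exact Finset.mem_mul.2 ⟨b⁻¹, Finset.mem_inv'.1 hb, a⁻¹, Finset.inv_mem_inv ha, by group⟩)
    (Fintype.card ι)
  let e : ι ≃ H := Fintype.equivOfCardEq (by simp [hcard])
  obtain ⟨s₀, hs₀, h₀⟩ := hX.exists_forall_eqOn (fun p : ι => (e p : G) • (W : Set G))
    (fun p => leftTranslate (e p : G) (r p)) (fun p => S.2 _ _ (hrS p)) (by
      intro p q hpq
      rw [Set.disjoint_left]
      rintro _ ⟨_, ⟨w, hw, rfl⟩, g, hg, rfl⟩ ⟨_, ⟨w', hw', rfl⟩, g', hg', he⟩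
      simp only [smul_eq_mul] at he
      refine hpq (e.injective (Subtype.ext (hH _ (e p).2 _ (e q).2 (Finset.mem_coe.2
        (Finset.mem_mul.2 ⟨w * g, Finset.mul_mem_mul hw hg, (w' * g')⁻¹,
          Finset.inv_mem_inv (Finset.mul_mem_mul hw' hg'), ?_⟩)))))
      have : (e q : G) = e p * w * g * (w' * g')⁻¹ := by rw [← he]; group
      rw [this]
      group)
  refine ⟨s₀, hs₀, H * W, ?_⟩
  intro s hs
  let p : ι := ⟨fun w => s w, s, hs, fun _ => rfl⟩
  refine ⟨e p, fun w hw => ⟨Finset.mul_mem_mul (e p).2 hw, ?_⟩⟩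
  have : s₀ (e p * w) = leftTranslate (e p : G) (r p) (e p * w) :=
    h₀ p (Set.smul_mem_smul_set hw)
  rw [this, leftTranslate, inv_mul_cancel_left]
  exact hr p ⟨w, hw⟩

/-! ### Planting a pattern along markers -/

/-- The configurations of `S` which carry the restriction of `s₀` to `K` at each element of a member
of `𝓜`. -/
def plantedSet (S : GShift G A) (𝓜 : Set (Set G)) (s₀ : G → A) (K : Finset G) : Set (G → A) :=
  {s | s ∈ S.1 ∧ ∃ P ∈ 𝓜, ∀ x ∈ P, ∀ k ∈ K, s (x * k) = s₀ k}

theorem isCompact_plantedSet [DiscreteTopology A] (S : GShift G A) {𝓜 : Set (Set G)}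
    (h𝓜 : IsClosed {f : G → Bool | boolSet f ∈ 𝓜}) (s₀ : G → A) (K : Finset G) :
    IsCompact (plantedSet S 𝓜 s₀ K) := by
  let L : Set ((G → A) × (G → Bool)) := (S.1 : Set (G → A)) ×ˢ {f | boolSet f ∈ 𝓜} ∩
    ⋂ x, ⋂ k ∈ K, {p | x ∈ boolSet p.2}ᶜ ∪ {p | p.1 (x * k) = s₀ k}
  have hL : IsCompact L := by
    refine (S.1.isCompact.prod h𝓜.isCompact).inter_right ?_
    refine isClosed_iInter fun x => isClosed_biInter fun k _ => ?_
    exact (isClopen_setOf_mem_boolSet continuous_snd x).compl.isClosed.union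
      (isClosed_eq ((continuous_apply _).comp continuous_fst) continuous_const)
  have : plantedSet S 𝓜 s₀ K = Prod.fst '' L := by
    ext s
    constructor
    · rintro ⟨hs, P, hP, h⟩
      obtain ⟨f, rfl⟩ := exists_boolSet_eq P
      refine ⟨(s, f), ⟨⟨hs, hP⟩, ?_⟩, rfl⟩
      simp only [Set.mem_iInter]
      intro x k hk
      by_cases hx : x ∈ boolSet f
      · exact Or.inr (h x hx k hk)
      · exact Or.inl hx
    · rintro ⟨⟨s, f⟩, ⟨⟨hs, hP⟩, h⟩, rfl⟩
      refine ⟨hs, boolSet f, hP, fun x hx k hk => ?_⟩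
      simp only [Set.mem_iInter] at h
      exact (h x k hk).resolve_left fun h' => h' hx
  rw [this]
  exact hL.image continuous_fst

theorem leftTranslate_mem_plantedSet (S : GShift G A) {𝓜 : Set (Set G)}
    (h𝓜 : ∀ P ∈ 𝓜, ∀ g : G, g • P ∈ 𝓜) (s₀ : G → A) (K : Finset G) (g : G) (s : G → A)
    (hs : s ∈ plantedSet S 𝓜 s₀ K) : leftTranslate g s ∈ plantedSet S 𝓜 s₀ K := by
  obtain ⟨hs, P, hP, h⟩ := hs
  refine ⟨S.2 g s hs, g • P, h𝓜 P hP g, ?_⟩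
  rintro _ ⟨x, hx, rfl⟩ k hk
  rw [← h x hx k hk]
  simp [leftTranslate, mul_assoc]

section

variable [DiscreteTopology A] {S : GShift G A} {X : Finset G} {K V : Finset G}

theorem disjoint_smul_mul_smul_mul {P : Set G} (hP : SeparatedBy (V : Set G) P)
    (hV : ((K : Set G) * X) * ((K : Set G) * X)⁻¹ ⊆ V) {x y : G} (hx : x ∈ P) (hy : y ∈ P)
    (hxy : x ≠ y) : Disjoint (x • (K : Set G) * X) (y • (K : Set G) * X) := by
  rw [Set.disjoint_left]
  rintro _ ⟨_, ⟨w, hw, rfl⟩, g, hg, rfl⟩ ⟨_, ⟨w', hw', rfl⟩, g', hg', he⟩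
  simp only [smul_eq_mul] at he
  refine hxy (hP x hx y hy (hV ⟨w * g, Set.mul_mem_mul hw hg, (w' * g')⁻¹,
    Set.inv_mem_inv.2 (Set.mul_mem_mul hw' hg'), ?_⟩))
  have : y = x * w * g * (w' * g')⁻¹ := by rw [← he]; group
  rw [this]
  group

theorem plantedSet_nonempty (hX : S.Glues X) {𝓜 : Set (Set G)}
    (h𝓜 : IsMarkerSystem (V : Set G) 𝓜) (hV : ((K : Set G) * X) * ((K : Set G) * X)⁻¹ ⊆ V)
    {s₀ : G → A} (hs₀ : s₀ ∈ S.1) : (plantedSet S 𝓜 s₀ K).Nonempty := by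
  obtain ⟨P, hP⟩ := h𝓜.nonempty
  obtain ⟨t, ht, htP⟩ := hX.exists_forall_eqOn (fun x : P => (x : G) • (K : Set G))
    (fun x => leftTranslate (x : G) s₀) (fun x => S.2 _ _ hs₀) fun x y hxy =>
      disjoint_smul_mul_smul_mul (h𝓜.separatedBy P hP) hV x.2 y.2 fun h => hxy (Subtype.ext h)
  refine ⟨t, ht, P, hP, fun x hx k hk => ?_⟩
  have : t (x * k) = leftTranslate x s₀ (x * k) := htP ⟨x, hx⟩ (Set.smul_mem_smul_set hk)
  rw [this]
  simp [leftTranslate]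

/-- The markers are amalgamated first. Those near Eᵢ are markers of sᵢ, so sᵢ already carries the
pattern there; at the others the pattern is planted by gluing. -/
theorem plantedSet_stronglyIrreducible (hX1 : 1 ∈ X) (hX : S.Glues X) {𝓜 : Set (Set G)}
    (h𝓜 : IsMarkerSystem (V : Set G) 𝓜) (hV : ((K : Set G) * X) * ((K : Set G) * X)⁻¹ ⊆ V)
    {s₀ : G → A} (hs₀ : s₀ ∈ S.1) :
    ∃ X' : Finset G, 1 ∈ X' ∧ ∀ E₁ E₂ : Set G,
      Disjoint (E₁ * (X' : Set G)) (E₂ * (X' : Set G)) →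
        ∀ s₁ ∈ plantedSet S 𝓜 s₀ K, ∀ s₂ ∈ plantedSet S 𝓜 s₀ K,
          ∃ s ∈ plantedSet S 𝓜 s₀ K, Set.EqOn s s₁ E₁ ∧ Set.EqOn s s₂ E₂ := by
  classical
  obtain ⟨Y, -, hY⟩ := h𝓜.exists_amalgam
  -- If x K X meets E X, then x ∈ E B.
  set B := X * X⁻¹ * K⁻¹ with hB
  refine ⟨X ∪ (B * K * X ∪ B * Y), by simp [hX1], ?_⟩
  rintro E₁ E₂ hE s₁ ⟨hs₁, P₁, hP₁, h₁⟩ s₂ ⟨hs₂, P₂, hP₂, h₂⟩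
  have hBY : ∀ E : Set G, E * (B : Set G) * Y ⊆ E * ((X ∪ (B * K * X ∪ B * Y) : Finset G)) := by
    intro E
    rw [mul_assoc]
    refine Set.mul_subset_mul le_rfl ?_
    push_cast
    exact Set.subset_union_right.trans Set.subset_union_right
  obtain ⟨P, hP, hPE₁, hPE₂⟩ := hY (E₁ * B) (E₂ * B) (hE.mono (hBY _) (hBY _)) P₁ hP₁ P₂ hP₂
  have hsep := h𝓜.separatedBy P hP
  -- E together with the whole tiles x K of the markers near it.
  let U : Set G → Set G := fun E => E ∪ (P ∩ (E * B)) * K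
  have hU : ∀ E : Set G, U E * X ⊆ E * ((X ∪ (B * K * X ∪ B * Y) : Finset G)) := by
    rintro E _ ⟨_, hx | ⟨x, ⟨-, e, he, b, hb, rfl⟩, k, hk, rfl⟩, g, hg, rfl⟩
    · exact Set.mul_mem_mul hx (by simp only [Finset.coe_union]; exact Or.inl hg)
    · refine ⟨e, he, b * k * g, ?_, by simp [mul_assoc]⟩
      simp only [Finset.coe_union]
      refine Or.inr (Or.inl ?_)
      exact_mod_cast Finset.mul_mem_mul (Finset.mul_mem_mul hb hk) hg
  have hUx : ∀ E : Set G, ∀ x ∈ P, x ∉ E * (B : Set G) →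
      Disjoint (U E * X) (x • (K : Set G) * X) := by
    intro E x hx hxE
    rw [Set.disjoint_left]
    rintro _ ⟨_, he | ⟨y, ⟨hy, hyE⟩, k, hk, rfl⟩, g, hg, rfl⟩ hz
    · obtain ⟨_, ⟨k, hk, rfl⟩, g', hg', heq⟩ := hz
      simp only [smul_eq_mul] at heq
      refine hxE ⟨_, he, g * g'⁻¹ * k⁻¹, ?_, ?_⟩
      · exact Finset.mul_mem_mul (Finset.mul_mem_mul hg (Finset.inv_mem_inv hg'))
          (Finset.inv_mem_inv hk)
      · simp only [← mul_assoc]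
        rw [← heq]
        group
    · refine Set.disjoint_left.1 (disjoint_smul_mul_smul_mul hsep hV hy hx ?_)
        (Set.mul_mem_mul (Set.smul_mem_smul_set hk) hg) hz
      rintro rfl
      exact hxE hyE
  let ι := Bool ⊕ {x // x ∈ P ∧ x ∉ E₁ * (B : Set G) ∧ x ∉ E₂ * (B : Set G)}
  let D : ι → Set G := Sum.elim (fun b => bif b then U E₁ else U E₂) fun x => x.1 • (K : Set G)
  let σ : ι → G → A := Sum.elim (fun b => bif b then s₁ else s₂) fun x => leftTranslate x.1 s₀
  obtain ⟨t, ht, htι⟩ := hX.exists_forall_eqOn D σ (by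
    rintro ((_ | _) | x)
    · exact hs₂
    · exact hs₁
    · exact S.2 _ _ hs₀) (by
    have h12 := hE.mono (hU E₁) (hU E₂)
    rintro ((_ | _) | x) ((_ | _) | y) hne
    · exact absurd rfl hne
    · exact h12.symm
    · exact hUx _ _ y.2.1 y.2.2.2
    · exact h12
    · exact absurd rfl hne
    · exact hUx _ _ y.2.1 y.2.2.1
    · exact (hUx _ _ x.2.1 x.2.2.2).symm
    · exact (hUx _ _ x.2.1 x.2.2.1).symm
    · exact disjoint_smul_mul_smul_mul hsep hV x.2.1 y.2.1
        fun h => hne (congrArg Sum.inr (Subtype.ext h)))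
  have ht₁ : Set.EqOn t s₁ (U E₁) := htι (Sum.inl true)
  have ht₂ : Set.EqOn t s₂ (U E₂) := htι (Sum.inl false)
  refine ⟨t, ⟨ht, P, hP, fun x hx k hk => ?_⟩, ht₁.mono Set.subset_union_left,
    ht₂.mono Set.subset_union_left⟩
  by_cases hx₁ : x ∈ E₁ * (B : Set G)
  · rw [ht₁ (Or.inr (Set.mul_mem_mul ⟨hx, hx₁⟩ hk))]
    exact h₁ x ((hPE₁ x hx₁).1 hx) k hk
  by_cases hx₂ : x ∈ E₂ * (B : Set G)
  · rw [ht₂ (Or.inr (Set.mul_mem_mul ⟨hx, hx₂⟩ hk))]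
    exact h₂ x ((hPE₂ x hx₂).1 hx) k hk
  have : t (x * k) = leftTranslate x s₀ (x * k) :=
    htι (Sum.inr ⟨x, hx, hx₁, hx₂⟩) (Set.smul_mem_smul_set hk)
  rw [this]
  simp [leftTranslate]

end

/-- A strongly irreducible shift over an ICC group contains a strongly irreducible shift with the
same patterns of a given finite shape `W`, all of whose pairs of points `W`-approximately satisfy
minimality and proximality. -/
theorem GShift.IsStronglyIrreducible.exists_subshift [DiscreteTopology A] [Finite A] [Nontrivial G]
    (hG : IsICC G) {S : GShift G A} (hS : S.IsStronglyIrreducible) (W : Finset G) :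
    ∃ S' : GShift G A, S'.IsStronglyIrreducible ∧ (∀ s ∈ S'.1, s ∈ S.1) ∧
      (∀ s ∈ S.1, ∃ s' ∈ S'.1, ∀ w ∈ W, s' w = s w) ∧
      (∀ s ∈ S'.1, ∀ s' ∈ S'.1, ∃ g, ∀ w ∈ W, s (g * w) = s' w) ∧
      ∀ s ∈ S'.1, ∀ s' ∈ S'.1, ∃ g, ∀ w ∈ W, s (g * w) = s' (g * w) := by
  classical
  have := hG.infinite
  obtain ⟨X, hX1, hX⟩ := hS
  have hX : S.Glues X := hX
  obtain ⟨s₀, hs₀, K, hK⟩ := hX.exists_rich W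
  -- V-separation of the markers keeps their tiles x K far enough apart for gluing with X.
  set V : Finset G := insert 1 ((K * X) * (K * X)⁻¹) with hVdef
  obtain ⟨𝓜, h𝓜⟩ := hG.exists_isMarkerSystem V (by simp [hVdef]) (by
    intro v hv
    rcases Finset.mem_insert.1 hv with rfl | hv
    · simp [hVdef]
    obtain ⟨a, ha, b, hb, rfl⟩ := Finset.mem_mul.1 hv
    exact Finset.mem_insert_of_mem (Finset.mem_mul.2
      ⟨b⁻¹, Finset.mem_inv'.1 hb, a⁻¹, Finset.inv_mem_inv ha, by group⟩))
  have hV : ((K : Set G) * X) * ((K : Set G) * X)⁻¹ ⊆ V := by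
    rw [hVdef]
    push_cast
    exact Set.subset_insert _ _
  let S' : GShift G A := ⟨⟨⟨plantedSet S 𝓜 s₀ K, isCompact_plantedSet S h𝓜.isClosed s₀ K⟩,
    plantedSet_nonempty hX h𝓜 hV hs₀⟩, leftTranslate_mem_plantedSet S h𝓜.smul_mem s₀ K⟩
  have hS' : ∀ s, s ∈ S'.1 ↔ s ∈ plantedSet S 𝓜 s₀ K := fun s => Iff.rfl
  have hpat : ∀ s ∈ S'.1, ∀ s' ∈ S.1, ∃ g, ∀ w ∈ W, s (g * w) = s' w := by
    rintro s ⟨-, P, hP, h⟩ s' hs'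
    obtain ⟨k, hk⟩ := hK s' hs'
    obtain ⟨x, hx, -⟩ := h𝓜.inter_nonempty P hP P hP
    refine ⟨x * k, fun w hw => ?_⟩
    rw [mul_assoc, h x hx _ (hk w hw).1, (hk w hw).2]
  refine ⟨S', plantedSet_stronglyIrreducible hX1 hX h𝓜 hV hs₀, fun s hs => hs.1, ?_,
    fun s hs s' hs' => hpat s hs s' hs'.1, ?_⟩
  · intro s hs
    obtain ⟨s', hs'⟩ := S'.1.nonempty
    obtain ⟨g, hg⟩ := hpat s' hs' s hs
    exact ⟨leftTranslate g⁻¹ s', S'.2 _ _ hs', fun w hw => by simpa [leftTranslate] using hg w hw⟩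
  · rintro s ⟨hs, P, hP, h⟩ s' ⟨-, P', hP', h'⟩
    obtain ⟨x, hx, hx'⟩ := h𝓜.inter_nonempty P hP P' hP'
    obtain ⟨k, hk⟩ := hK s hs
    refine ⟨x * k, fun w hw => ?_⟩
    rw [mul_assoc, h x hx _ (hk w hw).1, h' x hx' _ (hk w hw).1]

end Shifts

/-! ### Open conditions in the space of shifts -/

section SpaceOfShifts

variable {G A : Type*} [Group G] [TopologicalSpace A]

/-- Any two points of the shift agree on `W` up to translating the first one. -/
def GShift.ApproxMinimal (S : GShift G A) (W : Finset G) : Prop :=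
  ∀ s ∈ S.1, ∀ s' ∈ S.1, ∃ g, ∀ w ∈ W, s (g * w) = s' w

/-- Any two points of the shift agree on a translate of `W`. -/
def GShift.ApproxProximal (S : GShift G A) (W : Finset G) : Prop :=
  ∀ s ∈ S.1, ∀ s' ∈ S.1, ∃ g, ∀ w ∈ W, s (g * w) = s' (g * w)

theorem exists_cylinder_subset {ι : Type*} {U : Set (ι → A)} (hU : IsOpen U) {s : ι → A}
    (hs : s ∈ U) : ∃ W : Finset ι, ∀ s' : ι → A, (∀ w ∈ W, s' w = s w) → s' ∈ U := by
  obtain ⟨W, u, hu, hW⟩ := isOpen_pi_iff.1 hU s hs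
  exact ⟨W, fun s' h => hW fun w hw => by rw [h w hw]; exact (hu w hw).2⟩

theorem isOpen_cylinder [DiscreteTopology A] {ι X : Type*} [TopologicalSpace X] (W : Finset ι)
    {f f' : X → ι → A} (hf : Continuous f) (hf' : Continuous f') :
    IsOpen {x | ∀ w ∈ W, f x w = f' x w} := by
  have : {x | ∀ w ∈ W, f x w = f' x w} = ⋂ w ∈ W, {x | (f x w, f' x w) ∈ Set.diagonal A} := by
    ext x
    simp
  rw [this]
  exact isOpen_biInter_finset fun w _ => (isOpen_discrete _).preimage
    (((continuous_apply w).comp hf).prodMk ((continuous_apply w).comp hf'))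

theorem continuous_leftTranslate (g : G) : Continuous (leftTranslate g : (G → A) → G → A) :=
  continuous_pi fun h => continuous_apply (g⁻¹ * h)

namespace GShift

/-- A subshift with enough patterns is close to the shift. -/
theorem exists_forall_mem_of_isOpen {O : Set (GShift G A)} (hO : IsOpen O) {S : GShift G A}
    (hS : S ∈ O) : ∃ W : Finset G, ∀ S' : GShift G A, (∀ s ∈ S'.1, s ∈ S.1) →
      (∀ s ∈ S.1, ∃ s' ∈ S'.1, ∀ w ∈ W, s' w = s w) → S' ∈ O := by
  classical
  obtain ⟨O', hO', rfl⟩ := isOpen_induced_iff.1 hO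
  obtain ⟨_, ⟨u, ⟨hufin, -, hu⟩, rfl⟩, ⟨hSu, hSU⟩, hsub⟩ :=
    NonemptyCompacts.isTopologicalBasis.exists_subset_of_mem_open (show S.1 ∈ O' from hS) hO'
  have : ∀ U ∈ u, ∃ W : Finset G, ∃ s ∈ S.1, ∀ s' : G → A, (∀ w ∈ W, s' w = s w) → s' ∈ U := by
    intro U hU
    obtain ⟨s, hs, hsU⟩ := hSU U hU
    obtain ⟨W, hW⟩ := exists_cylinder_subset (hu U hU) hsU
    exact ⟨W, s, hs, hW⟩
  choose! W hW using this
  refine ⟨hufin.toFinset.biUnion W, fun S' hS' h => hsub ⟨fun s hs => hSu (hS' s hs), ?_⟩⟩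
  intro U hU
  obtain ⟨s, hs, hsU⟩ := hW U hU
  obtain ⟨s', hs', hw⟩ := h s hs
  exact ⟨s', hs', hsU s' fun w hw' => hw w
    (Finset.mem_biUnion.2 ⟨U, hufin.mem_toFinset.2 hU, hw'⟩)⟩

/-- The condition is S × S ⊆ O, and S ↦ S × S is continuous for the Vietoris topologies. -/
theorem isOpen_setOf_forall_pair {O : Set ((G → A) × (G → A))} (hO : IsOpen O) :
    IsOpen {S : GShift G A | ∀ s ∈ S.1, ∀ s' ∈ S.1, (s, s') ∈ O} := by
  have hc : Continuous fun S : GShift G A => S.1 ×ˢ S.1 :=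
    NonemptyCompacts.continuous_prod.comp (continuous_subtype_val.prodMk continuous_subtype_val)
  convert (NonemptyCompacts.isOpen_subsets_of_isOpen hO).preimage hc using 1
  ext S
  constructor
  · rintro h ⟨s, s'⟩ ⟨hs, hs'⟩
    exact h s hs s' hs'
  · intro h s hs s' hs'
    exact h (show (s, s') ∈ ((S.1 ×ˢ S.1 : NonemptyCompacts _) : Set _) from ⟨hs, hs'⟩)

theorem isOpen_setOf_approxMinimal [DiscreteTopology A] (W : Finset G) :
    IsOpen {S : GShift G A | S.ApproxMinimal W} := by
  have : IsOpen (⋃ g : G, {p : (G → A) × (G → A) | ∀ w ∈ W, leftTranslate g⁻¹ p.1 w = p.2 w}) :=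
    isOpen_iUnion fun g => isOpen_cylinder W
      ((continuous_leftTranslate g⁻¹).comp continuous_fst) continuous_snd
  convert isOpen_setOf_forall_pair this using 1
  ext S
  simp [ApproxMinimal, leftTranslate]

theorem isOpen_setOf_approxProximal [DiscreteTopology A] (W : Finset G) :
    IsOpen {S : GShift G A | S.ApproxProximal W} := by
  have : IsOpen (⋃ g : G, {p : (G → A) × (G → A) |
      ∀ w ∈ W, leftTranslate g⁻¹ p.1 w = leftTranslate g⁻¹ p.2 w}) :=
    isOpen_iUnion fun g => isOpen_cylinder W
      ((continuous_leftTranslate g⁻¹).comp continuous_fst)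
      ((continuous_leftTranslate g⁻¹).comp continuous_snd)
  convert isOpen_setOf_forall_pair this using 1
  ext S
  simp [ApproxProximal, leftTranslate]

theorem coe_smul_point {S : GShift G A} (g : G) (s : S.Point) (h : G) :
    (g • s).1 h = s.1 (g⁻¹ * h) := rfl

theorem isMinimal_iff [DiscreteTopology A] (S : GShift G A) :
    MulAction.IsMinimal G S.Point ↔ ∀ W, S.ApproxMinimal W := by
  constructor
  · intro h W s hs s' hs'
    obtain ⟨_, ⟨g, rfl⟩, hx⟩ := (h.dense_orbit ⟨s, hs⟩).exists_mem_open
      (isOpen_cylinder W (f := fun x : S.Point => x.1) (f' := fun _ => s')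
        continuous_subtype_val continuous_const) ⟨⟨s', hs'⟩, fun _ _ => rfl⟩
    exact ⟨g⁻¹, hx⟩
  · intro h
    refine ⟨fun s => dense_iff_inter_open.2 ?_⟩
    rintro O hO ⟨s', hs'⟩
    obtain ⟨U, hU, rfl⟩ := isOpen_induced_iff.1 hO
    obtain ⟨W, hW⟩ := exists_cylinder_subset hU hs'
    obtain ⟨g, hg⟩ := h W s.1 s.2 s'.1 s'.2
    exact ⟨g⁻¹ • s, hW _ fun w hw => by rw [coe_smul_point, inv_inv, hg w hw], g⁻¹, rfl⟩

theorem isProximalAction_iff [DiscreteTopology A] (S : GShift G A) :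
    IsProximalAction G S.Point ↔ ∀ W, S.ApproxProximal W := by
  constructor
  · intro h W s hs s' hs'
    obtain ⟨F, z, hF, h1, h2⟩ := h ⟨s, hs⟩ ⟨s', hs'⟩
    have hO : {x : S.Point | ∀ w ∈ W, x.1 w = z.1 w} ∈ 𝓝 z :=
      (isOpen_cylinder W (f := fun x : S.Point => x.1) (f' := fun _ => z.1)
        continuous_subtype_val continuous_const).mem_nhds fun _ _ => rfl
    obtain ⟨g, hg1, hg2⟩ := ((h1.eventually_mem hO).and (h2.eventually_mem hO)).exists
    exact ⟨g⁻¹, fun w hw => (hg1 w hw).trans (hg2 w hw).symm⟩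
  · intro h x y
    choose γ hγ using fun W => h W x.1 x.2 y.1 y.2
    have : CompactSpace S.Point := isCompact_iff_compactSpace.1 S.1.isCompact
    -- Along an ultrafilter finer than `atTop` the translates of x converge by compactness. Those of
    -- y have the same limit, since they agree with them at g once W contains g.
    let u : Ultrafilter (Finset G) := Ultrafilter.of atTop
    have hu : (u : Filter (Finset G)) ≤ atTop := Ultrafilter.of_le atTop
    obtain ⟨z, -, hz⟩ := isCompact_univ.ultrafilter_le_nhds
      (u.map fun W => (γ W)⁻¹ • x) (by simp)
    have hz' : Tendsto (fun W => (γ W)⁻¹ • x) u (𝓝 z) := hz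
    refine ⟨map (fun W => (γ W)⁻¹) u, z, inferInstance, tendsto_map'_iff.2 hz',
      tendsto_map'_iff.2 ?_⟩
    rw [tendsto_subtype_rng, tendsto_pi_nhds] at hz' ⊢
    intro g
    refine (hz' g).congr' ?_
    filter_upwards [hu (eventually_ge_atTop {g})] with W hW
    have := hγ W g (hW (Finset.mem_singleton_self g))
    simpa [coe_smul_point] using this

theorem isClosed_setOf_isTrivial [T2Space A] : IsClosed {S : GShift G A | S.IsTrivial} := by
  convert (NonemptyCompacts.isClosedEmbedding_singleton (α := G → A)).isClosed_range.preimage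
    (continuous_subtype_val (p := fun S : NonemptyCompacts (G → A) =>
      ∀ (g : G) (s : G → A), s ∈ S → leftTranslate g s ∈ S)) using 1
  ext S
  refine exists_congr fun s => ?_
  rw [eq_comm, ← NonemptyCompacts.coe_singleton, SetLike.coe_set_eq]

instance [T2Space A] [CompactSpace A] : CompactSpace (GShift G A) := by
  have hclosed : IsClosed {S : NonemptyCompacts (G → A) |
      ∀ (g : G) (s : G → A), s ∈ S → leftTranslate g s ∈ S} := by
    -- Invariance under g is the equation S ∪ g S = S between continuous functions of S.
    have : {S : NonemptyCompacts (G → A) |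
        ∀ (g : G) (s : G → A), s ∈ S → leftTranslate g s ∈ S} =
        ⋂ g : G, {S | S ⊔ S.map (leftTranslate g) (continuous_leftTranslate g) = S} := by
      ext S
      simp only [Set.mem_ofPred_eq, Set.mem_iInter]
      refine forall_congr' fun g => ?_
      rw [sup_eq_left, ← SetLike.coe_subset_coe, NonemptyCompacts.coe_map, Set.image_subset_iff]
      rfl
    rw [this]
    exact isClosed_iInter fun g => isClosed_eq
      (continuous_id.sup (continuous_leftTranslate g).nonemptyCompacts_map) continuous_id
  exact isCompact_iff_compactSpace.1 hclosed.isCompact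

end GShift

/-! ### The category argument -/

theorem baireSpace_shiftSpace [T2Space A] [CompactSpace A] : BaireSpace (shiftSpace G A) := by
  have : LocallyCompactSpace (shiftSpace G A) :=
    (isClosed_closure.isLocallyClosed.inter
      GShift.isClosed_setOf_isTrivial.isOpen_compl.isLocallyClosed).locallyCompactSpace
  exact .of_t2Space_locallyCompactSpace

theorem dense_approxMinimal_approxProximal [DiscreteTopology A] [Finite A] [Nontrivial G]
    (hG : IsICC G) (W : Finset G) :
    Dense {S : shiftSpace G A | S.1.ApproxMinimal W ∧ S.1.ApproxProximal W} := by
  classical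
  refine dense_iff_inter_open.2 ?_
  rintro O hO ⟨S, hS⟩
  obtain ⟨O', hO', rfl⟩ := isOpen_induced_iff.1 hO
  -- Being non-trivial is open, so it passes to the strongly irreducible approximant and then to its
  -- subshift.
  have hopen : IsOpen (O' ∩ {S | S.IsTrivial}ᶜ) :=
    hO'.inter GShift.isClosed_setOf_isTrivial.isOpen_compl
  obtain ⟨S₁, hS₁, hSI⟩ := mem_closure_iff.1 S.2.1 _ hopen ⟨hS, S.2.2⟩
  obtain ⟨W₁, hW₁⟩ := GShift.exists_forall_mem_of_isOpen hopen hS₁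
  obtain ⟨S', hSI', hsub, hpat, hmin, hprox⟩ :=
    GShift.IsStronglyIrreducible.exists_subshift hG hSI (W ∪ W₁)
  obtain ⟨hS'O, hS't⟩ := hW₁ S' hsub fun s hs => by
    obtain ⟨s', hs', h⟩ := hpat s hs
    exact ⟨s', hs', fun w hw => h w (Finset.mem_union_right _ hw)⟩
  refine ⟨⟨S', subset_closure hSI', hS't⟩, hS'O, fun s hs s' hs' => ?_, fun s hs s' hs' => ?_⟩
  · obtain ⟨g, hg⟩ := hmin s hs s' hs'
    exact ⟨g, fun w hw => hg w (Finset.mem_union_left _ hw)⟩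
  · obtain ⟨g, hg⟩ := hprox s hs s' hs'
    exact ⟨g, fun w hw => hg w (Finset.mem_union_left _ hw)⟩

end SpaceOfShifts

theorem mainTheorem5 (G : Type*) [Group G] [Countable G] [Nontrivial G] (hG : IsICC G)
    (A : Type*) [Finite A] [Nontrivial A] [TopologicalSpace A] [DiscreteTopology A] :
    IsGδ {S : shiftSpace G A |
        MulAction.IsMinimal G S.1.Point ∧ IsProximalAction G S.1.Point} ∧
      Dense {S : shiftSpace G A |
        MulAction.IsMinimal G S.1.Point ∧ IsProximalAction G S.1.Point} := by
  have heq : {S : shiftSpace G A |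
      MulAction.IsMinimal G S.1.Point ∧ IsProximalAction G S.1.Point} =
      ⋂ W : Finset G, {S | S.1.ApproxMinimal W ∧ S.1.ApproxProximal W} := by
    ext S
    simp only [Set.mem_ofPred_eq, GShift.isMinimal_iff, GShift.isProximalAction_iff,
      Set.mem_iInter, forall_and]
  have hopen : ∀ W : Finset G,
      IsOpen {S : shiftSpace G A | S.1.ApproxMinimal W ∧ S.1.ApproxProximal W} := fun W =>
    ((GShift.isOpen_setOf_approxMinimal W).inter
      (GShift.isOpen_setOf_approxProximal W)).preimage continuous_subtype_val
  have := baireSpace_shiftSpace (G := G) (A := A)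
  rw [heq]
  exact ⟨.iInter_of_isOpen hopen,
    dense_iInter_of_isOpen hopen (dense_approxMinimal_approxProximal hG)⟩
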